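/- Notation. Let $C$ be the space of continuous $2\pi$-periodic functions $f:\mathbb R\to\mathbb R$ with $\|f\|_C=\max_t|f(t)|$, and $L_s$, $1\le s\le\infty$, the space of $2\pi$-periodic functions with the norm $\|f\|_s=\big(\int_0^{2\pi}|f(t)|^s\,dt\big)^{1/s}$ for $s<\infty$ and $\|f\|_\infty=\operatorname{ess\,sup}_t|f(t)|$. For $f\in L_1$ with Fourier coefficients $a_k,b_k$ let $S_k(f;x)=\frac{a_0}2+\sum_{j=1}^k(a_j\cos jx+b_j\sin jx)$ and, for $n,p\in\mathbb N$, $p\le n$, $$V_{n,p}(f;x)=\frac1p\sum_{k=n-p}^{n-1}S_k(f;x),\qquad \rho_{n,p}(f;x)=f(x)-V_{n,p}(f;x).$$ Given $\psi(k)>0$ and $\beta\in\mathbb R$, if $\sum_{k\ge1}\frac1{\psi(k)}\big(a_k\cos(kx+\frac{\beta\pi}2)+b_k\sin(kx+\frac{\beta\pi}2)\big)$ is the Fourier series of a summable $2\pi$-periodic function, this function is denoted by $f^\psi_\beta$; $C^\psi_\beta L_s$ is the set of $f\in C$ for which $f^\psi_\beta$ exists and lies in $L_s$. $E_m(\varphi)_{L_s}$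 is the infimum of $\|\varphi-t\|_s$ over trigonometric polynomials $t$ of order at most $m-1$. For $q\in(0,1)$, $l\in\mathbb N=\{1,2,\dots\}$ put $$\psi_l(k)=q^k\Big(1+\sum_{j=1}^{l-1}\frac{(1-q^2)^j}{j!\,2^j}\prod_{\nu=0}^{j-1}(k+2\nu)\Big).$$ For $1\le u\le\infty$ put $$K_{q,p}(u)=2^{-1/u}\Big\|\frac{\sqrt{1-2q^p\cos pt+q^{2p}}}{1-2q\cos t+q^2}\Big\|_u,$$ $\sigma(1,1)=1$, $\sigma(u,1)=2$ for $1<u\le\infty$, and $\sigma(u,p)=3$ for $p\ge2$; let $\delta(2)=0$ and $\delta(s)=1$ for $s\in[1,\infty]\setminus\{2\}$. Let $\frac1s+\frac1{s'}=1$ (with $1/\infty=0$) and $$M=\frac{\|\cos t\|_{s'}}{\pi^{1+1/s'}}K_{q,p}(s'),\qquad R=\frac{q\,\delta(s)}{(n-p+1)(1-q)^{\sigma(s',p)}}+\frac{l\,q}{(n-p+1)(1-q)^2}\min\Big\{p,\frac1{1-q}\Big\}.$$ Statement. There exist an absolute constant $C$, constants $C'_l$ depending only on $l$, and natural numbers $N(l,q)$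 depending only on $l$ and $q$, such that for all $l\in\mathbb N$, $q\in(0,1)$, $\beta\in\mathbb R$, $1\le s\le\infty$, $n,p\in\mathbb N$ with $p\le n$, and all $f\in C^\psi_\beta L_s$, where $\psi=\psi_l$, the following hold. (i) For some real $\theta$, $$\|\rho_{n,p}(f;\cdot)\|_C\le\frac{\psi_l(n-p+1)}p\,\big(M+\theta R\big)\,E_{n-p+1}(f^\psi_\beta)_{L_s}.$$ (ii) There is a function $F=F(f;n;p;\cdot)\in C^\psi_\beta L_s$ such that $E_{n-p+1}(F^\psi_\beta)_{L_s}=E_{n-p+1}(f^\psi_\beta)_{L_s}$ and, for some real $\theta$, $$\|\rho_{n,p}(F;\cdot)\|_C=\frac{\psi_l(n-p+1)}p\,\big(M+\theta R\big)\,E_{n-p+1}(F^\psi_\beta)_{L_s}.$$ In both (i) and (ii), $|\theta|\le C'_l$ always, and $|\theta|\le C$ whenever $n-p\ge N(l,q)$. -/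

import Mathlib

open MeasureTheory Set
open scoped ENNReal

namespace ValleePoussin

noncomputable section

/-- Lebesgue measure on one period. -/
def periodMeasure : Measure ℝ := volume.restrict (Ioc 0 (2 * Real.pi))

/-- The norm of `L_s`, `1 ≤ s ≤ ∞`, with respect to (unnormalised) Lebesgue measure on `[0, 2π]`. -/
def lsNorm (s : ℝ≥0∞) (f : ℝ → ℝ) : ℝ := (eLpNorm f s periodMeasure).toReal

/-- The space `L_s` of `2π`-periodic functions. -/
def MemLs (s : ℝ≥0∞) (f : ℝ → ℝ) : Prop :=
  Function.Periodic f (2 * Real.pi) ∧ MemLp f s periodMeasure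

/-- The space `C` of continuous `2π`-periodic functions. -/
def MemC (f : ℝ → ℝ) : Prop :=
  Function.Periodic f (2 * Real.pi) ∧ Continuous f

/-- The norm of `C`. -/
def cNorm (f : ℝ → ℝ) : ℝ := ⨆ x : ℝ, |f x|

/-- The Fourier cosine coefficient `a_k`. -/
def cosCoeff (f : ℝ → ℝ) (k : ℕ) : ℝ :=
  (1 / Real.pi) * ∫ t in (-Real.pi)..Real.pi, f t * Real.cos (k * t)

/-- The Fourier sine coefficient `b_k`. -/
def sinCoeff (f : ℝ → ℝ) (k : ℕ) : ℝ :=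
  (1 / Real.pi) * ∫ t in (-Real.pi)..Real.pi, f t * Real.sin (k * t)

/-- The partial Fourier sum `S_k(f; x)` of order `k`. -/
def fourierSum (f : ℝ → ℝ) (k : ℕ) (x : ℝ) : ℝ :=
  cosCoeff f 0 / 2 +
    ∑ j ∈ Finset.Icc 1 k, (cosCoeff f j * Real.cos (j * x) + sinCoeff f j * Real.sin (j * x))

/-- The de la Vallée Poussin sum `V_{n,p}(f; x)`. -/
def valleePoussin (n p : ℕ) (f : ℝ → ℝ) (x : ℝ) : ℝ :=
  (1 / (p : ℝ)) * ∑ k ∈ Finset.Ico (n - p) n, fourierSum f k x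

/-- The deviation `ρ_{n,p}(f; x) = f(x) - V_{n,p}(f; x)`. -/
def deviation (n p : ℕ) (f : ℝ → ℝ) (x : ℝ) : ℝ := f x - valleePoussin n p f x

/-- `φ` is (a version of) the `(ψ, β)`-derivative of the summable `2π`-periodic function `f`: it is
summable and `2π`-periodic, and its Fourier series is
`∑_{k ≥ 1} (1 / ψ(k)) (a_k cos (kx + βπ/2) + b_k sin (kx + βπ/2))`. -/
def IsPsiBetaDeriv (ψ : ℕ → ℝ) (β : ℝ) (f φ : ℝ → ℝ) : Prop :=
  MemLs 1 f ∧ MemLs 1 φ ∧ cosCoeff φ 0 = 0 ∧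
    ∀ k : ℕ, 1 ≤ k → ∀ x : ℝ,
      cosCoeff φ k * Real.cos (k * x) + sinCoeff φ k * Real.sin (k * x) =
        (1 / ψ k) * (cosCoeff f k * Real.cos (k * x + β * Real.pi / 2) +
          sinCoeff f k * Real.sin (k * x + β * Real.pi / 2))

/-- `f` belongs to `C^ψ_β L_s`, and `φ` is its `(ψ, β)`-derivative (unique up to a null set). -/
def MemCPsiBeta (ψ : ℕ → ℝ) (β : ℝ) (s : ℝ≥0∞) (f φ : ℝ → ℝ) : Prop :=
  MemC f ∧ IsPsiBetaDeriv ψ β f φ ∧ MemLs s φ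

/-- The trigonometric polynomial of order at most `m - 1` (`m ≥ 1`) with coefficients `a`, `b`. -/
def trigPoly (m : ℕ) (a b : ℕ → ℝ) (x : ℝ) : ℝ :=
  ∑ k ∈ Finset.range m, (a k * Real.cos (k * x) + b k * Real.sin (k * x))

/-- The best approximation `E_m(φ)_{L_s}` by trigonometric polynomials of order at most `m - 1`. -/
def bestApprox (m : ℕ) (s : ℝ≥0∞) (φ : ℝ → ℝ) : ℝ :=
  ⨅ c : (ℕ → ℝ) × (ℕ → ℝ), lsNorm s (fun x => φ x - trigPoly m c.1 c.2 x)

/-- The coefficients `ψ_l(k)` of the polyharmonic Poisson kernels. -/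
def polyPsi (q : ℝ) (l k : ℕ) : ℝ :=
  q ^ k * (1 + ∑ j ∈ Finset.Icc 1 (l - 1),
    (1 - q ^ 2) ^ j / ((j.factorial : ℝ) * 2 ^ j) *
      ∏ ν ∈ Finset.range j, ((k : ℝ) + 2 * (ν : ℝ)))

/-- `K_{q,p}(u)`, `1 ≤ u ≤ ∞` (with `1 / ∞ = 0`). -/
def constK (q : ℝ) (p : ℕ) (u : ℝ≥0∞) : ℝ :=
  (2 : ℝ) ^ (-(u⁻¹).toReal) *
    lsNorm u (fun t => Real.sqrt (1 - 2 * q ^ p * Real.cos (p * t) + q ^ (2 * p)) /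
      (1 - 2 * q * Real.cos t + q ^ 2))

/-- The exponent `σ(u,p)`. -/
def sigmaExp (u : ℝ≥0∞) (p : ℕ) : ℕ :=
  if p = 1 then (if u = 1 then 1 else 2) else 3

/-- `δ(s)`. -/
def deltaFn (s : ℝ≥0∞) : ℝ := if s = 2 then 0 else 1

/-- The leading constant `‖cos‖_{u} K_{q,p}(u) / π^{1 + 1/u}`. -/
def mainTerm (q : ℝ) (p : ℕ) (u : ℝ≥0∞) : ℝ :=
  lsNorm u Real.cos / Real.pi ^ (1 + (u⁻¹).toReal) * constK q p u

/-- The expression in the remainder that is multiplied by `O(1)`; here `u` is the exponent conjugate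
to `s` and `m = n - p + 1`. -/
def remainder (q : ℝ) (l m p : ℕ) (s u : ℝ≥0∞) : ℝ :=
  q * deltaFn s / ((m : ℝ) * (1 - q) ^ sigmaExp u p) +
    (l : ℝ) * q / ((m : ℝ) * (1 - q) ^ 2) * min (p : ℝ) (1 / (1 - q))

end

end ValleePoussin

namespace ValleePoussin

/-! Put `m = n - p + 1` and let `φ` be the `(ψ, β)`-derivative of `f`. Frequency `m + j` is missed
by exactly `min (j + 1) p` of the partial sums in the mean, so `p * ρ` is `1 / π` times the
convolution of `φ` with the kernel `∑ min (j + 1) p * ψ (m + j) * cos ((m + j) y - βπ/2)`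
(`deviation_eq_integral`). The kernel has no frequency below `m`, so any polynomial of order at most
`m - 1` may be subtracted from `φ`; Hölder then bounds the deviation by the best approximation times
the kernel's `L_{s'}` norm (`abs_integral_mul_tailKernel_le`). Conversely a nearly extremal `φ` for
Hölder, centred and rescaled, attains this bound up to an arbitrarily small loss
(`exists_bestApprox_eq_and_le_integral`). The loss is charged to the strictly positive remainder
`R`, and `θ` is then found by solving a linear equation.

It remains to compute the kernel norm, `abs_lsNorm_kernel_sub_le`. Write `ψ (m + j) / ψ m = q ^ j +
q ^ j * (P (m + j) / P m - 1)` with `P` the polynomial factor. The second part is of order `j / m`,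
and summing it gives the second term of `R` (`polyPsi_ratio_bound`).

The first part is `Re (e^{i (m t + γ)} g t)` with `g t = (1 - z ^ p) / (1 - z) ^ 2`, `z = q e^{it}`.
Averaging the `u`-th power of its norm over the phase `γ` gives exactly the main term `π M`. A
change of phase by `τ` is a translation by `τ / m` followed by replacing the translate of `g` by
`g`, so the norms for all phases agree up to the `L_u` modulus of continuity of `g` at `2π / m`
(`abs_lsNorm_modulated_sub_le`). Lipschitz bounds for `g` produce the exponents `σ`. For `s = 2`
analyticity removes the dependence on the phase altogether (`lsNorm_two_modulated_eq`), whence `δ(2)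
= 0`. -/

/-! ### Periodic functions, translation invariance, and uniqueness of Fourier coefficients. -/

theorem intervalIntegral_eq_periodMeasure {E : Type*} [NormedAddCommGroup E] [NormedSpace ℝ E]
    {f : ℝ → E} (hf : Function.Periodic f (2 * Real.pi)) :
    ∫ t in (-Real.pi)..Real.pi, f t = ∫ t, f t ∂periodMeasure := by
  have h := hf.intervalIntegral_add_eq (-Real.pi) 0
  rw [show -Real.pi + 2 * Real.pi = Real.pi by ring, zero_add] at h
  rw [h, intervalIntegral.integral_of_le Real.two_pi_pos.le, periodMeasure]

theorem periodMeasure_univ : periodMeasure univ = ENNReal.ofReal (2 * Real.pi) := by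
  simp [periodMeasure]

instance : IsFiniteMeasure periodMeasure := ⟨by rw [periodMeasure_univ]; exact ENNReal.ofReal_lt_top⟩

theorem periodMeasure_real_univ : periodMeasure.real univ = 2 * Real.pi := by
  rw [Measure.real, periodMeasure_univ, ENNReal.toReal_ofReal Real.two_pi_pos.le]

theorem cos_nat_mul_periodic (k : ℕ) : Function.Periodic (fun t => Real.cos (k * t)) (2 * Real.pi) := by
  intro t
  simp only [mul_add]
  exact Real.cos_add_nat_mul_two_pi _ _

theorem sin_nat_mul_periodic (k : ℕ) : Function.Periodic (fun t => Real.sin (k * t)) (2 * Real.pi) := by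
  intro t
  simp only [mul_add]
  exact Real.sin_add_nat_mul_two_pi _ _

theorem cosCoeff_eq {f : ℝ → ℝ} (hf : Function.Periodic f (2 * Real.pi)) (k : ℕ) :
    cosCoeff f k = (1 / Real.pi) * ∫ t, f t * Real.cos (k * t) ∂periodMeasure := by
  rw [cosCoeff, intervalIntegral_eq_periodMeasure]
  exact hf.mul (cos_nat_mul_periodic k)

theorem sinCoeff_eq {f : ℝ → ℝ} (hf : Function.Periodic f (2 * Real.pi)) (k : ℕ) :
    sinCoeff f k = (1 / Real.pi) * ∫ t, f t * Real.sin (k * t) ∂periodMeasure := by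
  rw [sinCoeff, intervalIntegral_eq_periodMeasure]
  exact hf.mul (sin_nat_mul_periodic k)

theorem measurePreserving_addCircle_mk [Fact (0 < 2 * Real.pi)] :
    MeasurePreserving ((↑) : ℝ → AddCircle (2 * Real.pi)) periodMeasure volume := by
  have := AddCircle.measurePreserving_mk (2 * Real.pi) 0
  rwa [zero_add] at this

theorem exists_addCircle_lift {E : Type*} [TopologicalSpace E] {h : ℝ → E}
    (hp : Function.Periodic h (2 * Real.pi)) (hc : Continuous h) :
    ∃ H : C(AddCircle (2 * Real.pi), E), ∀ x : ℝ, H x = h x :=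
  ⟨⟨hp.lift, continuous_coinduced_dom.mpr hc⟩, fun _ => rfl⟩

/-- The function descends to the circle, where translation preserves the measure. Continuity makes
the descent immediate and suffices for every kernel used below. -/
theorem eLpNorm_add_right {E : Type*} [NormedAddCommGroup E] [SecondCountableTopology E]
    {h : ℝ → E} (hp : Function.Periodic h (2 * Real.pi)) (hc : Continuous h) (u : ℝ≥0∞) (x : ℝ) :
    eLpNorm (fun t => h (t + x)) u periodMeasure = eLpNorm h u periodMeasure := by
  have : Fact (0 < 2 * Real.pi) := ⟨Real.two_pi_pos⟩
  obtain ⟨H, hH⟩ := exists_addCircle_lift hp hc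
  have h1 : (fun t => h (t + x)) = (fun y => H (y + (x : AddCircle (2 * Real.pi)))) ∘
      ((↑) : ℝ → AddCircle (2 * Real.pi)) := by
    funext t; simp [← hH]
  have h2 : h = H ∘ ((↑) : ℝ → AddCircle (2 * Real.pi)) := by
    funext t; simp [← hH]
  rw [h1, eLpNorm_comp_measurePreserving (by fun_prop) measurePreserving_addCircle_mk, h2,
    eLpNorm_comp_measurePreserving (by fun_prop) measurePreserving_addCircle_mk]
  exact eLpNorm_comp_measurePreserving (by fun_prop)
    (measurePreserving_add_right volume (x : AddCircle (2 * Real.pi)))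

theorem eLpNorm_sub_left {E : Type*} [NormedAddCommGroup E] [SecondCountableTopology E]
    {h : ℝ → E} (hp : Function.Periodic h (2 * Real.pi)) (hc : Continuous h) (u : ℝ≥0∞) (x : ℝ) :
    eLpNorm (fun t => h (x - t)) u periodMeasure = eLpNorm h u periodMeasure := by
  have : Fact (0 < 2 * Real.pi) := ⟨Real.two_pi_pos⟩
  obtain ⟨H, hH⟩ := exists_addCircle_lift hp hc
  have h1 : (fun t => h (x - t)) = (fun y => H ((x : AddCircle (2 * Real.pi)) - y)) ∘
      ((↑) : ℝ → AddCircle (2 * Real.pi)) := by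
    funext t; simp [← hH]
  have h2 : h = H ∘ ((↑) : ℝ → AddCircle (2 * Real.pi)) := by
    funext t; simp [← hH]
  rw [h1, eLpNorm_comp_measurePreserving (by fun_prop) measurePreserving_addCircle_mk, h2,
    eLpNorm_comp_measurePreserving (by fun_prop) measurePreserving_addCircle_mk]
  exact eLpNorm_comp_measurePreserving (by fun_prop)
    (Measure.measurePreserving_sub_left volume (x : AddCircle (2 * Real.pi)))

theorem continuous_bounded_of_periodic {E : Type*} [NormedAddCommGroup E] {h : ℝ → E}
    (hp : Function.Periodic h (2 * Real.pi)) (hc : Continuous h) : ∃ B, ∀ t, ‖h t‖ ≤ B := by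
  have : Fact (0 < 2 * Real.pi) := ⟨Real.two_pi_pos⟩
  obtain ⟨H, hH⟩ := exists_addCircle_lift hp hc
  exact ⟨‖H‖, fun t => hH t ▸ H.norm_coe_le_norm _⟩

theorem memLp_of_continuous_periodic {E : Type*} [NormedAddCommGroup E] [SecondCountableTopology E]
    {h : ℝ → E} (hp : Function.Periodic h (2 * Real.pi)) (hc : Continuous h) (u : ℝ≥0∞) :
    MemLp h u periodMeasure := by
  obtain ⟨B, hB⟩ := continuous_bounded_of_periodic hp hc
  exact MemLp.of_bound hc.aestronglyMeasurable B (Filter.Eventually.of_forall hB)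

theorem abs_integral_mul_le_lsNorm {s u : ℝ≥0∞} (hsu : s⁻¹ + u⁻¹ = 1) {φ h : ℝ → ℝ}
    (hφ : MemLp φ s periodMeasure) (hh : MemLp h u periodMeasure) :
    |∫ t, φ t * h t ∂periodMeasure| ≤ lsNorm s φ * lsNorm u h := by
  have : ENNReal.HolderTriple s u 1 := ⟨by simpa using hsu⟩
  have h1 := eLpNorm_smul_le_mul_eLpNorm (p := s) (q := u) (r := 1) hh.1 hφ.1
  have h2 : Integrable (fun t => φ t * h t) periodMeasure := by
    have := hh.smul hφ (r := 1)
    exact memLp_one_iff_integrable.mp this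
  rw [lsNorm, lsNorm, ← ENNReal.toReal_mul]
  have h3 : |∫ t, φ t * h t ∂periodMeasure| ≤ (eLpNorm (fun t => φ t * h t) 1 periodMeasure).toReal := by
    rw [eLpNorm_one_eq_lintegral_enorm, ← integral_norm_eq_lintegral_enorm h2.1]
    exact norm_integral_le_integral_norm (fun t => φ t * h t)
  exact h3.trans (ENNReal.toReal_mono (ENNReal.mul_ne_top hφ.eLpNorm_ne_top hh.eLpNorm_ne_top) h1)

/-- A continuous function on the circle with summable Fourier coefficients is the pointwise sum of
its Fourier series; here that series is identically zero. -/
theorem eq_zero_of_fourier_coeff_eq_zero {h : ℝ → ℝ} (hh : MemC h) (ha : ∀ k, cosCoeff h k = 0)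
    (hb : ∀ k, sinCoeff h k = 0) : h = 0 := by
  have : Fact (0 < 2 * Real.pi) := ⟨Real.two_pi_pos⟩
  have hp : Function.Periodic (fun x => (h x : ℂ)) (2 * Real.pi) := fun x => by simp [hh.1 x]
  have hcont := hh.2
  obtain ⟨H, hH⟩ := exists_addCircle_lift hp (by fun_prop)
  have hcos : ∀ k : ℕ, ∫ t in (-Real.pi)..Real.pi, h t * Real.cos (k * t) = 0 := fun k => by
    have := ha k
    simpa [cosCoeff, Real.pi_ne_zero] using this
  have hsin : ∀ k : ℕ, ∫ t in (-Real.pi)..Real.pi, h t * Real.sin (k * t) = 0 := fun k => by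
    have := hb k
    simpa [sinCoeff, Real.pi_ne_zero] using this
  have hcos' : ∀ n : ℤ, ∫ t in (-Real.pi)..Real.pi, h t * Real.cos (n * t) = 0 := fun n => by
    obtain ⟨k, rfl | rfl⟩ := n.eq_nat_or_neg
    · simpa using hcos k
    · simpa using hcos k
  have hsin' : ∀ n : ℤ, ∫ t in (-Real.pi)..Real.pi, h t * Real.sin (n * t) = 0 := fun n => by
    obtain ⟨k, rfl | rfl⟩ := n.eq_nat_or_neg
    · simpa using hsin k
    · simpa using hsin k
  have hc : fourierCoeff H = 0 := by
    funext n
    rw [fourierCoeff_eq_intervalIntegral H n (-Real.pi)]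
    rw [show -Real.pi + 2 * Real.pi = Real.pi by ring]
    have : ∀ x : ℝ, fourier (-n) (x : AddCircle (2 * Real.pi)) • H x =
        ((h x * Real.cos (n * x) : ℝ) : ℂ) - ((h x * Real.sin (n * x) : ℝ) : ℂ) * Complex.I := by
      intro x
      rw [hH, fourier_coe_apply]
      have : (2 * Real.pi * Complex.I * ((-n : ℤ) : ℂ) * x / ((2 * Real.pi : ℝ) : ℂ)) =
          (-(n * x : ℝ) : ℝ) * Complex.I := by
        have : (Real.pi : ℂ) ≠ 0 := by exact_mod_cast Real.pi_ne_zero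
        push_cast
        field_simp
      rw [this, Complex.exp_mul_I, ← Complex.ofReal_cos, ← Complex.ofReal_sin, Real.cos_neg,
        Real.sin_neg]
      push_cast
      simp only [smul_eq_mul]
      ring
    simp_rw [this]
    rw [intervalIntegral.integral_sub, intervalIntegral.integral_mul_const,
      intervalIntegral.integral_ofReal, intervalIntegral.integral_ofReal, hcos', hsin']
    · simp
    · exact Continuous.intervalIntegrable (by fun_prop) _ _
    · exact Continuous.intervalIntegrable (by fun_prop) _ _
  have h0 := has_pointwise_sum_fourier_series_of_summable (f := H) (by rw [hc]; exact summable_zero)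
  funext x
  have := h0 x
  simp only [hc, Pi.zero_apply, zero_smul] at this
  have := this.unique hasSum_zero
  rw [hH] at this
  exact_mod_cast this

theorem integral_cos_int_mul (n : ℤ) :
    ∫ t, Real.cos (n * t) ∂periodMeasure = if n = 0 then 2 * Real.pi else 0 := by
  rw [periodMeasure, ← intervalIntegral.integral_of_le Real.two_pi_pos.le]
  split_ifs with h
  · simp [h]
  · rw [intervalIntegral.integral_comp_mul_left _ (by exact_mod_cast h : (n : ℝ) ≠ 0), integral_cos]
    have : Real.sin (n * (2 * Real.pi)) = 0 := by
      have := Real.sin_int_mul_pi (n * 2)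
      rw [← this]; push_cast; ring_nf
    simp [this]

theorem integral_sin_int_mul (n : ℤ) : ∫ t, Real.sin (n * t) ∂periodMeasure = 0 := by
  rw [periodMeasure, ← intervalIntegral.integral_of_le Real.two_pi_pos.le]
  by_cases h : n = 0
  · simp [h]
  · rw [intervalIntegral.integral_comp_mul_left _ (by exact_mod_cast h : (n : ℝ) ≠ 0), integral_sin]
    simp [Real.cos_int_mul_two_pi]

theorem integrable_periodMeasure {h : ℝ → ℝ} (hc : Continuous h) : Integrable h periodMeasure :=
  (hc.integrableOn_Icc (a := 0) (b := 2 * Real.pi)).mono_set Ioc_subset_Icc_self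

theorem integral_cos_mul_cos (k j : ℕ) : ∫ t, Real.cos (k * t) * Real.cos (j * t) ∂periodMeasure =
    (if k = j then Real.pi else 0) + if k + j = 0 then Real.pi else 0 := by
  have h : ∀ t : ℝ, Real.cos (k * t) * Real.cos (j * t) =
      (1 / 2) * Real.cos (((k : ℤ) - j : ℤ) * t) + (1 / 2) * Real.cos (((k : ℤ) + j : ℤ) * t) := by
    intro t
    push_cast
    rw [sub_mul, add_mul, Real.cos_sub, Real.cos_add]; ring
  simp_rw [h]
  rw [integral_add (integrable_periodMeasure (by fun_prop)) (integrable_periodMeasure (by fun_prop)),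
    integral_const_mul, integral_const_mul, integral_cos_int_mul, integral_cos_int_mul]
  have h1 : ((k : ℤ) - j = 0) ↔ k = j := by omega
  have h2 : ((k : ℤ) + j = 0) ↔ k + j = 0 := by omega
  simp only [h1, h2]
  split_ifs <;> ring

theorem integral_sin_mul_sin (k j : ℕ) : ∫ t, Real.sin (k * t) * Real.sin (j * t) ∂periodMeasure =
    (if k = j then Real.pi else 0) - if k + j = 0 then Real.pi else 0 := by
  have h : ∀ t : ℝ, Real.sin (k * t) * Real.sin (j * t) =
      (1 / 2) * Real.cos (((k : ℤ) - j : ℤ) * t) - (1 / 2) * Real.cos (((k : ℤ) + j : ℤ) * t) := by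
    intro t
    push_cast
    rw [sub_mul, add_mul, Real.cos_sub, Real.cos_add]; ring
  simp_rw [h]
  rw [integral_sub (integrable_periodMeasure (by fun_prop)) (integrable_periodMeasure (by fun_prop)),
    integral_const_mul, integral_const_mul, integral_cos_int_mul, integral_cos_int_mul]
  have h1 : ((k : ℤ) - j = 0) ↔ k = j := by omega
  have h2 : ((k : ℤ) + j = 0) ↔ k + j = 0 := by omega
  simp only [h1, h2]
  split_ifs <;> ring

theorem integral_sin_mul_cos (k j : ℕ) :
    ∫ t, Real.sin (k * t) * Real.cos (j * t) ∂periodMeasure = 0 := by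
  have h : ∀ t : ℝ, Real.sin (k * t) * Real.cos (j * t) =
      (1 / 2) * Real.sin (((k : ℤ) - j : ℤ) * t) + (1 / 2) * Real.sin (((k : ℤ) + j : ℤ) * t) := by
    intro t
    push_cast
    rw [sub_mul, add_mul, Real.sin_sub, Real.sin_add]; ring
  simp_rw [h]
  rw [integral_add (integrable_periodMeasure (by fun_prop)) (integrable_periodMeasure (by fun_prop)),
    integral_const_mul, integral_const_mul, integral_sin_int_mul, integral_sin_int_mul]
  simp

theorem hasSum_integral_mul_of_le {φ : ℝ → ℝ} (hφ : Integrable φ periodMeasure) {v : ℕ → ℝ → ℝ}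
    {B : ℕ → ℝ} (hv : ∀ k, Continuous (v k)) (hB : Summable B) (hvB : ∀ k t, |v k t| ≤ B k) :
    HasSum (fun k => ∫ t, φ t * v k t ∂periodMeasure)
      (∫ t, φ t * ∑' k, v k t ∂periodMeasure) := by
  have hs : ∀ t, Summable fun k => v k t := fun t => Summable.of_norm_bounded hB (fun k => hvB k t)
  refine hasSum_integral_of_dominated_convergence (fun k t => |φ t| * B k)
    (fun k => hφ.1.mul (hv k).aestronglyMeasurable) (fun k => ?_) ?_ ?_ ?_
  · refine Filter.Eventually.of_forall fun t => ?_
    rw [norm_mul]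
    exact mul_le_mul_of_nonneg_left (hvB k t) (abs_nonneg _)
  · exact Filter.Eventually.of_forall fun t => hB.mul_left _
  · simp_rw [tsum_mul_left]
    exact hφ.norm.mul_const _
  · exact Filter.Eventually.of_forall fun t => (hs t).hasSum.mul_left _

/-! ### Absolutely convergent trigonometric series and the expansion of the deviation. -/

/-- The sum of a trigonometric series. -/
noncomputable def trigSeries (a b : ℕ → ℝ) (x : ℝ) : ℝ :=
  ∑' k, (a k * Real.cos (k * x) + b k * Real.sin (k * x))

theorem abs_trig_term_le (a b x : ℝ) : |a * Real.cos x + b * Real.sin x| ≤ |a| + |b| := by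
  refine (abs_add_le _ _).trans (add_le_add ?_ ?_)
  · rw [abs_mul]
    exact mul_le_of_le_one_right (abs_nonneg _) (Real.abs_cos_le_one _)
  · rw [abs_mul]
    exact mul_le_of_le_one_right (abs_nonneg _) (Real.abs_sin_le_one _)

theorem trigSeries_hasSum {a b : ℕ → ℝ} (ha : Summable fun k => |a k|)
    (hb : Summable fun k => |b k|) (x : ℝ) :
    HasSum (fun k => a k * Real.cos (k * x) + b k * Real.sin (k * x)) (trigSeries a b x) :=
  (Summable.of_norm_bounded (ha.add hb) fun _ => abs_trig_term_le _ _ _).hasSum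

theorem trigSeries_memC {a b : ℕ → ℝ} (ha : Summable fun k => |a k|)
    (hb : Summable fun k => |b k|) : MemC (trigSeries a b) := by
  refine ⟨fun x => ?_, ?_⟩
  · refine tsum_congr fun k => ?_
    have h1 := cos_nat_mul_periodic k x
    have h2 := sin_nat_mul_periodic k x
    simp only at h1 h2
    rw [h1, h2]
  · exact continuous_tsum (fun k => by fun_prop) (ha.add hb) fun _ _ => abs_trig_term_le _ _ _

/-- The zeroth coefficient doubles because `cosCoeff` carries the factor `1 / π` also for `k = 0`,
matching the convention `a_0 / 2`. -/
theorem cosCoeff_trigSeries {a b : ℕ → ℝ} (ha : Summable fun k => |a k|)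
    (hb : Summable fun k => |b k|) (j : ℕ) :
    cosCoeff (trigSeries a b) j = a j + if j = 0 then a j else 0 := by
  rw [cosCoeff_eq (trigSeries_memC ha hb).1]
  have h := hasSum_integral_mul_of_le (φ := fun t => Real.cos (j * t))
    (integrable_periodMeasure (by fun_prop))
    (v := fun k t => a k * Real.cos (k * t) + b k * Real.sin (k * t)) (by fun_prop) (ha.add hb)
    fun _ _ => abs_trig_term_le _ _ _
  have h2 : ∀ k, ∫ t, Real.cos (j * t) * (a k * Real.cos (k * t) + b k * Real.sin (k * t))
      ∂periodMeasure = if k = j then Real.pi * (a j + if j = 0 then a j else 0) else 0 := by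
    intro k
    have : ∀ t, Real.cos (j * t) * (a k * Real.cos (k * t) + b k * Real.sin (k * t)) =
      a k * (Real.cos (k * t) * Real.cos (j * t)) + b k * (Real.sin (k * t) * Real.cos (j * t)) :=
      fun t => by ring
    simp_rw [this]
    rw [integral_add (integrable_periodMeasure (by fun_prop))
      (integrable_periodMeasure (by fun_prop)), integral_const_mul, integral_const_mul,
      integral_cos_mul_cos, integral_sin_mul_cos]
    by_cases hk : k = j
    · subst hk
      by_cases h0 : k = 0 <;> simp [h0] <;> ring
    · have hkj : ¬ k + j = 0 := by omega
      simp only [if_neg hk, if_neg hkj]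
      simp
  simp_rw [h2] at h
  have h3 := h.unique (hasSum_ite_eq j _)
  have h4 : ∀ t, trigSeries a b t * Real.cos (j * t) =
    Real.cos (j * t) * ∑' k, (a k * Real.cos (k * t) + b k * Real.sin (k * t)) :=
    fun t => mul_comm _ _
  simp_rw [h4]
  rw [h3]
  field_simp [Real.pi_ne_zero]

theorem sinCoeff_trigSeries {a b : ℕ → ℝ} (ha : Summable fun k => |a k|)
    (hb : Summable fun k => |b k|) (j : ℕ) :
    sinCoeff (trigSeries a b) j = if j = 0 then 0 else b j := by
  rw [sinCoeff_eq (trigSeries_memC ha hb).1]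
  have h := hasSum_integral_mul_of_le (φ := fun t => Real.sin (j * t))
    (integrable_periodMeasure (by fun_prop))
    (v := fun k t => a k * Real.cos (k * t) + b k * Real.sin (k * t)) (by fun_prop) (ha.add hb)
    fun _ _ => abs_trig_term_le _ _ _
  have h2 : ∀ k, ∫ t, Real.sin (j * t) * (a k * Real.cos (k * t) + b k * Real.sin (k * t))
      ∂periodMeasure = if k = j then Real.pi * (if j = 0 then 0 else b j) else 0 := by
    intro k
    have : ∀ t, Real.sin (j * t) * (a k * Real.cos (k * t) + b k * Real.sin (k * t)) =
      a k * (Real.sin (j * t) * Real.cos (k * t)) + b k * (Real.sin (k * t) * Real.sin (j * t)) :=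
      fun t => by ring
    simp_rw [this]
    rw [integral_add (integrable_periodMeasure (by fun_prop))
      (integrable_periodMeasure (by fun_prop)), integral_const_mul, integral_const_mul,
      integral_sin_mul_sin, integral_sin_mul_cos]
    by_cases hk : k = j
    · subst hk
      by_cases h0 : k = 0 <;> simp [h0]; ring
    · have hkj : ¬ k + j = 0 := by omega
      simp only [if_neg hk, if_neg hkj]
      simp
  simp_rw [h2] at h
  have h3 := h.unique (hasSum_ite_eq j _)
  have h4 : ∀ t, trigSeries a b t * Real.sin (j * t) =
    Real.sin (j * t) * ∑' k, (a k * Real.cos (k * t) + b k * Real.sin (k * t)) :=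
    fun t => mul_comm _ _
  simp_rw [h4]
  rw [h3]
  field_simp [Real.pi_ne_zero]

theorem eq_of_fourier_coeff_eq {f g : ℝ → ℝ} (hf : MemC f) (hg : MemC g)
    (ha : ∀ k, cosCoeff f k = cosCoeff g k) (hb : ∀ k, sinCoeff f k = sinCoeff g k) : f = g := by
  have hfc := hf.2
  have hgc := hg.2
  have h := eq_zero_of_fourier_coeff_eq_zero (h := f - g) ⟨hf.1.sub hg.1, hf.2.sub hg.2⟩ ?_ ?_
  · exact sub_eq_zero.mp h
  · intro k
    have := ha k
    simp only [cosCoeff, Pi.sub_apply, sub_mul] at this ⊢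
    rw [intervalIntegral.integral_sub, mul_sub, this, sub_self]
    · exact Continuous.intervalIntegrable (by fun_prop) _ _
    · exact Continuous.intervalIntegrable (by fun_prop) _ _
  · intro k
    have := hb k
    simp only [sinCoeff, Pi.sub_apply, sub_mul] at this ⊢
    rw [intervalIntegral.integral_sub, mul_sub, this, sub_self]
    · exact Continuous.intervalIntegrable (by fun_prop) _ _
    · exact Continuous.intervalIntegrable (by fun_prop) _ _

/-- `S_k` omits the frequency `n - p + 1 + j` exactly when `k ≤ n - p + j`, and among `n - p ≤ k <
n` there are `min (j + 1) p` such indices. -/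
theorem hasSum_deviation {f : ℝ → ℝ} (hf : MemC f) (ha : Summable fun k => |cosCoeff f k|)
    (hb : Summable fun k => |sinCoeff f k|) {n p : ℕ} (hp : 1 ≤ p) (hpn : p ≤ n) (x : ℝ) :
    HasSum (fun j : ℕ => (min (j + 1) p : ℕ) *
      (cosCoeff f (n - p + 1 + j) * Real.cos ((n - p + 1 + j : ℕ) * x) +
        sinCoeff f (n - p + 1 + j) * Real.sin ((n - p + 1 + j : ℕ) * x)))
      (p * deviation n p f x) := by
  set a : ℕ → ℝ := fun k => if k = 0 then cosCoeff f 0 / 2 else cosCoeff f k with ha_def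
  have ha' : Summable fun k => |a k| := by
    refine Summable.of_nonneg_of_le (fun _ => abs_nonneg _) (fun k => ?_) ha
    rcases eq_or_ne k 0 with rfl | h
    · simp only [ha_def, if_true, abs_div, abs_two]
      linarith [abs_nonneg (cosCoeff f 0)]
    · simp [ha_def, h]
  have hfs : f = trigSeries a (sinCoeff f) := by
    refine eq_of_fourier_coeff_eq hf (trigSeries_memC ha' hb) (fun k => ?_) fun k => ?_
    · rw [cosCoeff_trigSeries ha' hb]
      rcases eq_or_ne k 0 with rfl | h
      · simp [ha_def]
      · simp [ha_def, h]
    · rw [sinCoeff_trigSeries ha' hb]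
      rcases eq_or_ne k 0 with rfl | h
      · simp [sinCoeff]
      · simp [h]
  set v : ℕ → ℝ := fun k => a k * Real.cos (k * x) + sinCoeff f k * Real.sin (k * x) with hv
  have h0 : HasSum v (f x) := by
    have := trigSeries_hasSum ha' hb x
    rwa [← hfs] at this
  have hS : ∀ k, fourierSum f k x = ∑ i ∈ Finset.range (k + 1), v i := by
    intro k
    rw [fourierSum, Finset.sum_range_eq_add_Ico _ (by omega)]
    congr 1
    · simp [hv, ha_def]
    · refine Finset.sum_congr (by ext i; simp only [Finset.mem_Icc, Finset.mem_Ico]; omega)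
        fun i hi => ?_
      have : i ≠ 0 := by simp only [Finset.mem_Ico] at hi; omega
      simp [hv, ha_def, this]
  have h1 : ∀ k, HasSum (fun i => if k < i then v i else 0) (f x - fourierSum f k x) := by
    intro k
    have h2 : HasSum (fun i => if i ∈ Finset.range (k + 1) then v i else 0)
        (fourierSum f k x) := by
      rw [hS, Finset.sum_congr rfl fun i hi => (if_pos hi).symm]
      exact hasSum_sum_of_ne_finset_zero fun i hi => if_neg hi
    convert! h0.sub h2 using 1
    funext i
    simp only [Finset.mem_range]
    by_cases h : k < i
    · simp [h, show ¬ i < k + 1 by omega]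
    · simp [h, show i < k + 1 by omega]
  have h3 := hasSum_sum (s := Finset.Ico (n - p) n) fun k _ => h1 k
  have h4 : ∑ k ∈ Finset.Ico (n - p) n, (f x - fourierSum f k x) = p * deviation n p f x := by
    have hp0 : (p : ℝ) ≠ 0 := by exact_mod_cast (by omega : p ≠ 0)
    rw [Finset.sum_sub_distrib, Finset.sum_const, Nat.card_Ico, deviation, valleePoussin,
      show n - (n - p) = p by omega, nsmul_eq_mul]
    field_simp
  rw [h4] at h3
  -- Frequencies up to `n - p` belong to every partial sum and cancel, so the series may be indexed
  -- by the remaining ones.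
  have hinj : Function.Injective fun j : ℕ => n - p + 1 + j := add_right_injective _
  rw [← hinj.hasSum_iff] at h3
  · convert h3 using 1
    funext j
    simp only [Function.comp_apply, Finset.sum_ite, Finset.sum_const_zero, add_zero,
      Finset.sum_const, nsmul_eq_mul]
    have : (Finset.Ico (n - p) n).filter (fun k => k < n - p + 1 + j) =
        Finset.Ico (n - p) (n - p + min (j + 1) p) := by
      ext i; simp only [Finset.mem_filter, Finset.mem_Ico]; omega
    rw [this, Nat.card_Ico, Nat.add_sub_cancel_left]
    simp [hv, ha_def]
  · intro i hi
    refine Finset.sum_eq_zero fun k hk => ?_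
    rw [if_neg]
    intro hki
    simp only [Finset.mem_Ico] at hk
    exact hi ⟨i - (n - p + 1), by simp only; omega⟩

/-! ### The convolution kernel of the deviation and its orthogonality to low frequencies. -/

/-- The trigonometric series `∑ w_j cos ((m + j) y + γ)`. -/
noncomputable def tailKernel (m : ℕ) (w : ℕ → ℝ) (γ y : ℝ) : ℝ :=
  ∑' j, w j * Real.cos ((m + j : ℕ) * y + γ)

theorem abs_mul_cos_le (a x : ℝ) : |a * Real.cos x| ≤ |a| := by
  rw [abs_mul]
  exact mul_le_of_le_one_right (abs_nonneg _) (Real.abs_cos_le_one _)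

theorem tailKernel_memC (m : ℕ) {w : ℕ → ℝ} (hw : Summable fun j => |w j|) (γ : ℝ) :
    MemC (tailKernel m w γ) := by
  refine ⟨fun x => ?_, ?_⟩
  · refine tsum_congr fun k => ?_
    rw [mul_add, add_right_comm, Real.cos_add_nat_mul_two_pi]
  · exact continuous_tsum (fun k => by fun_prop) hw fun _ _ => abs_mul_cos_le _ _

theorem cos_coeff_mul_add_sin_coeff_mul {φ : ℝ → ℝ} (hφ : MemLs 1 φ) (k : ℕ) (y : ℝ) :
    cosCoeff φ k * Real.cos y + sinCoeff φ k * Real.sin y =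
      (1 / Real.pi) * ∫ t, φ t * Real.cos (y - k * t) ∂periodMeasure := by
  rw [cosCoeff_eq hφ.1, sinCoeff_eq hφ.1]
  have hi : Integrable φ periodMeasure := memLp_one_iff_integrable.mp hφ.2
  have h1 : Integrable (fun t => φ t * Real.cos (k * t)) periodMeasure :=
    hi.mul_bdd (c := 1) (Continuous.aestronglyMeasurable (by fun_prop))
      (Filter.Eventually.of_forall fun t => Real.abs_cos_le_one _)
  have h2 : Integrable (fun t => φ t * Real.sin (k * t)) periodMeasure :=
    hi.mul_bdd (c := 1) (Continuous.aestronglyMeasurable (by fun_prop))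
      (Filter.Eventually.of_forall fun t => Real.abs_sin_le_one _)
  have : ∀ t, φ t * Real.cos (y - k * t) =
      (φ t * Real.cos (k * t)) * Real.cos y + (φ t * Real.sin (k * t)) * Real.sin y := by
    intro t; rw [Real.cos_sub]; ring
  simp_rw [this]
  rw [integral_add (h1.mul_const _) (h2.mul_const _), integral_mul_const, integral_mul_const]
  ring

theorem hasSum_integral_tailKernel {φ : ℝ → ℝ} (hφ : MemLs 1 φ) (m : ℕ) {w : ℕ → ℝ}
    (hw : Summable fun j => |w j|) (γ x : ℝ) :
    HasSum (fun j => w j * (cosCoeff φ (m + j) * Real.cos ((m + j : ℕ) * x + γ) +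
      sinCoeff φ (m + j) * Real.sin ((m + j : ℕ) * x + γ)))
      ((1 / Real.pi) * ∫ t, φ t * tailKernel m w γ (x - t) ∂periodMeasure) := by
  have hi : Integrable φ periodMeasure := memLp_one_iff_integrable.mp hφ.2
  have h := (hasSum_integral_mul_of_le hi
    (v := fun j t => w j * Real.cos ((m + j : ℕ) * (x - t) + γ)) (by fun_prop) hw
    fun _ _ => abs_mul_cos_le _ _).mul_left (1 / Real.pi)
  convert! h using 1
  funext j
  rw [cos_coeff_mul_add_sin_coeff_mul hφ, mul_left_comm, ← integral_const_mul]
  congr 1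
  refine integral_congr_ae (Filter.Eventually.of_forall fun t => ?_)
  simp only
  rw [show ((m + j : ℕ) : ℝ) * x + γ - (m + j : ℕ) * t = (m + j : ℕ) * (x - t) + γ by ring]
  ring

theorem psiBetaDeriv_coeff {ψ : ℕ → ℝ} {β : ℝ} {f φ : ℝ → ℝ} (h : IsPsiBetaDeriv ψ β f φ) {k : ℕ}
    (hk : 1 ≤ k) (hψ : 0 < ψ k) :
    cosCoeff f k = ψ k * (cosCoeff φ k * Real.cos (β * Real.pi / 2) -
        sinCoeff φ k * Real.sin (β * Real.pi / 2)) ∧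
      sinCoeff f k = ψ k * (cosCoeff φ k * Real.sin (β * Real.pi / 2) +
        sinCoeff φ k * Real.cos (β * Real.pi / 2)) := by
  have hk0 : (k : ℝ) ≠ 0 := by exact_mod_cast (by omega : k ≠ 0)
  -- The points `0` and `π / (2k)` isolate the two coefficients of the derivative; inverting the
  -- rotation by `βπ/2` recovers those of `f`.
  have h1 := h.2.2.2 k hk 0
  have h2 := h.2.2.2 k hk (Real.pi / 2 / k)
  rw [mul_div_cancel₀ _ hk0] at h2
  simp only [mul_zero, Real.cos_zero, Real.sin_zero, zero_add, mul_one, add_zero,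
    Real.cos_pi_div_two, Real.sin_pi_div_two] at h1 h2
  rw [add_comm (Real.pi / 2), Real.cos_add_pi_div_two, Real.sin_add_pi_div_two] at h2
  have hsc := Real.sin_sq_add_cos_sq (β * Real.pi / 2)
  rw [h1, h2]
  constructor
  · field_simp
    linear_combination (-cosCoeff f k) * hsc
  · field_simp
    linear_combination (-sinCoeff f k) * hsc

theorem abs_cosCoeff_le {φ : ℝ → ℝ} (hφ : MemLs 1 φ) (k : ℕ) :
    |cosCoeff φ k| ≤ (1 / Real.pi) * ∫ t, |φ t| ∂periodMeasure := by
  rw [cosCoeff_eq hφ.1, abs_mul, abs_of_pos (by positivity : 0 < 1 / Real.pi)]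
  refine mul_le_mul_of_nonneg_left ?_ (by positivity)
  refine (abs_integral_le_integral_abs).trans (integral_mono_of_nonneg
    (Filter.Eventually.of_forall fun t => abs_nonneg _) (memLp_one_iff_integrable.mp hφ.2).abs
    (Filter.Eventually.of_forall fun t => ?_))
  exact abs_mul_cos_le _ _

theorem abs_sinCoeff_le {φ : ℝ → ℝ} (hφ : MemLs 1 φ) (k : ℕ) :
    |sinCoeff φ k| ≤ (1 / Real.pi) * ∫ t, |φ t| ∂periodMeasure := by
  rw [sinCoeff_eq hφ.1, abs_mul, abs_of_pos (by positivity : 0 < 1 / Real.pi)]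
  refine mul_le_mul_of_nonneg_left ?_ (by positivity)
  refine (abs_integral_le_integral_abs).trans (integral_mono_of_nonneg
    (Filter.Eventually.of_forall fun t => abs_nonneg _) (memLp_one_iff_integrable.mp hφ.2).abs
    (Filter.Eventually.of_forall fun t => ?_))
  simp only [abs_mul]
  exact mul_le_of_le_one_right (abs_nonneg _) (Real.abs_sin_le_one _)

theorem abs_mul_sub_mul_le {c A B x y D : ℝ} (hc : 0 ≤ c) (hA : |A| ≤ D) (hB : |B| ≤ D)
    (hx : |x| ≤ 1) (hy : |y| ≤ 1) : |c * (A * x - B * y)| ≤ c * (2 * D) := by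
  rw [abs_mul, abs_of_nonneg hc]
  refine mul_le_mul_of_nonneg_left ((abs_sub _ _).trans ?_) hc
  rw [abs_mul, abs_mul]
  nlinarith [mul_le_of_le_one_right (abs_nonneg A) hx, mul_le_of_le_one_right (abs_nonneg B) hy]

theorem abs_mul_add_mul_le {c A B x y D : ℝ} (hc : 0 ≤ c) (hA : |A| ≤ D) (hB : |B| ≤ D)
    (hx : |x| ≤ 1) (hy : |y| ≤ 1) : |c * (A * x + B * y)| ≤ c * (2 * D) := by
  have := abs_mul_sub_mul_le (B := -B) hc hA (by rwa [abs_neg]) hx hy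
  simpa using this

/-- The coefficients of `φ` are bounded by `D`, so those of `f` are `O(ψ k)` and summable. The
rotation by `βπ/2` in the definition of the derivative becomes the phase `-βπ/2` of the kernel. -/
theorem deviation_eq_integral {ψ : ℕ → ℝ} {β : ℝ} {f φ : ℝ → ℝ} (hψ : ∀ k, 0 < ψ k)
    (hψs : Summable ψ) (hf : MemC f) (h : IsPsiBetaDeriv ψ β f φ) {n p : ℕ} (hp : 1 ≤ p)
    (hpn : p ≤ n) (x : ℝ) :
    p * deviation n p f x = (1 / Real.pi) * ∫ t, φ t *
      tailKernel (n - p + 1) (fun j => (min (j + 1) p : ℕ) * ψ (n - p + 1 + j))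
        (-(β * Real.pi / 2)) (x - t) ∂periodMeasure := by
  set D := (1 / Real.pi) * ∫ t, |φ t| ∂periodMeasure
  have ha : Summable fun k => |cosCoeff f k| := by
    rw [← summable_nat_add_iff 1]
    refine Summable.of_nonneg_of_le (fun _ => abs_nonneg _) (fun k => ?_)
      (((summable_nat_add_iff 1).mpr hψs).mul_right (2 * D))
    rw [(psiBetaDeriv_coeff h (by omega) (hψ _)).1]
    exact abs_mul_sub_mul_le (hψ _).le (abs_cosCoeff_le h.2.1 _) (abs_sinCoeff_le h.2.1 _)
      (Real.abs_cos_le_one _) (Real.abs_sin_le_one _)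
  have hb : Summable fun k => |sinCoeff f k| := by
    rw [← summable_nat_add_iff 1]
    refine Summable.of_nonneg_of_le (fun _ => abs_nonneg _) (fun k => ?_)
      (((summable_nat_add_iff 1).mpr hψs).mul_right (2 * D))
    rw [(psiBetaDeriv_coeff h (by omega) (hψ _)).2]
    exact abs_mul_add_mul_le (hψ _).le (abs_cosCoeff_le h.2.1 _) (abs_sinCoeff_le h.2.1 _)
      (Real.abs_sin_le_one _) (Real.abs_cos_le_one _)
  have hw : Summable fun j : ℕ => |((min (j + 1) p : ℕ) : ℝ) * ψ (n - p + 1 + j)| := by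
    have : Summable fun j => ψ (n - p + 1 + j) :=
      hψs.comp_injective (add_right_injective (n - p + 1))
    refine Summable.of_nonneg_of_le (fun _ => abs_nonneg _) (fun j => ?_) (this.mul_left (p : ℝ))
    rw [abs_of_nonneg (mul_nonneg (Nat.cast_nonneg _) (hψ _).le)]
    exact mul_le_mul_of_nonneg_right (by exact_mod_cast min_le_right _ _) (hψ _).le
  refine (hasSum_deviation hf ha hb hp hpn x).unique ?_
  convert hasSum_integral_tailKernel h.2.1 (n - p + 1) hw (-(β * Real.pi / 2)) x using 1
  funext j
  obtain ⟨h1, h2⟩ := psiBetaDeriv_coeff h (k := n - p + 1 + j) (by omega) (hψ _)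
  rw [h1, h2, Real.cos_add, Real.sin_add, Real.cos_neg, Real.sin_neg]
  ring

theorem integral_trigPoly_mul_tailKernel {m : ℕ} {w : ℕ → ℝ} (hw : Summable fun j => |w j|)
    (a b : ℕ → ℝ) (γ x : ℝ) :
    ∫ t, trigPoly m a b t * tailKernel m w γ (x - t) ∂periodMeasure = 0 := by
  have hc : Continuous (trigPoly m a b) := by
    unfold trigPoly; fun_prop
  have h := hasSum_integral_mul_of_le (integrable_periodMeasure hc)
    (v := fun j t => w j * Real.cos ((m + j : ℕ) * (x - t) + γ)) (by fun_prop) hw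
    fun _ _ => abs_mul_cos_le _ _
  refine h.unique ?_
  convert hasSum_zero with j
  have : ∀ t, trigPoly m a b t * (w j * Real.cos ((m + j : ℕ) * (x - t) + γ)) =
      ∑ k ∈ Finset.range m,
        ((a k * w j * Real.cos ((m + j : ℕ) * x + γ)) *
            (Real.cos (k * t) * Real.cos ((m + j : ℕ) * t)) +
          (a k * w j * Real.sin ((m + j : ℕ) * x + γ)) *
            (Real.sin ((m + j : ℕ) * t) * Real.cos (k * t)) +
          (b k * w j * Real.cos ((m + j : ℕ) * x + γ)) *
            (Real.sin (k * t) * Real.cos ((m + j : ℕ) * t)) +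
          (b k * w j * Real.sin ((m + j : ℕ) * x + γ)) *
            (Real.sin (k * t) * Real.sin ((m + j : ℕ) * t))) := by
    intro t
    rw [trigPoly, Finset.sum_mul]
    refine Finset.sum_congr rfl fun k _ => ?_
    rw [show ((m + j : ℕ) : ℝ) * (x - t) + γ = ((m + j : ℕ) * x + γ) - (m + j : ℕ) * t by ring,
      Real.cos_sub]
    ring
  simp_rw [this]
  rw [integral_finsetSum _ fun k _ => integrable_periodMeasure (by fun_prop)]
  refine Finset.sum_eq_zero fun k hk => ?_
  have hk' := Finset.mem_range.mp hk
  rw [integral_add (integrable_periodMeasure (by fun_prop))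
      (integrable_periodMeasure (by fun_prop)), integral_add (integrable_periodMeasure (by fun_prop))
      (integrable_periodMeasure (by fun_prop)), integral_add (integrable_periodMeasure (by fun_prop))
      (integrable_periodMeasure (by fun_prop))]
  simp only [integral_const_mul, integral_cos_mul_cos, integral_sin_mul_cos, integral_sin_mul_sin]
  rw [if_neg (by omega), if_neg (by omega)]
  simp

/-! ### Oscillation of the polynomial factor of `ψ_l`. -/

theorem one_add_pow_sub_one_le {y : ℝ} (hy : 0 ≤ y) (i : ℕ) :
    (1 + y) ^ i - 1 ≤ i * y * (1 + y) ^ i := by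
  induction i with
  | zero => simp
  | succ i ih =>
    have h1 : (1 : ℝ) ≤ (1 + y) ^ i := one_le_pow₀ (by linarith)
    rw [pow_succ]
    push_cast
    have h2 : 0 ≤ (i : ℝ) * y * (1 + y) ^ i * y := by positivity
    have h3 : 0 ≤ y * (1 + y) ^ i * y := by positivity
    nlinarith

/-- The `i`-th summand of the polynomial factor `ψ_l(k) / q^k`. -/
noncomputable def polyTerm (q : ℝ) (i k : ℕ) : ℝ :=
  (1 - q ^ 2) ^ i / ((i.factorial : ℝ) * 2 ^ i) * ∏ ν ∈ Finset.range i, ((k : ℝ) + 2 * (ν : ℝ))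

/-- The polynomial factor `ψ_l(k) / q^k`. -/
noncomputable def polyFactor (q : ℝ) (l k : ℕ) : ℝ := 1 + ∑ i ∈ Finset.Icc 1 (l - 1), polyTerm q i k

theorem polyPsi_eq (q : ℝ) (l k : ℕ) : polyPsi q l k = q ^ k * polyFactor q l k := rfl

section polyFactor

variable {q : ℝ} {l m j i : ℕ}

theorem polyTerm_nonneg (h0 : 0 < q) (h1 : q < 1) : 0 ≤ polyTerm q i m := by
  have : 0 ≤ 1 - q ^ 2 := by nlinarith
  unfold polyTerm
  positivity

theorem one_le_polyFactor (h0 : 0 < q) (h1 : q < 1) : 1 ≤ polyFactor q l m := by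
  rw [polyFactor]
  linarith [Finset.sum_nonneg fun i (_ : i ∈ Finset.Icc 1 (l - 1)) =>
    polyTerm_nonneg (i := i) (m := m) h0 h1]

theorem polyTerm_le_polyFactor (h0 : 0 < q) (h1 : q < 1) (hi : i ∈ Finset.Icc 1 (l - 1)) :
    polyTerm q i m ≤ polyFactor q l m := by
  have := Finset.single_le_sum (f := fun i => polyTerm q i m)
    (fun i _ => polyTerm_nonneg (i := i) (m := m) h0 h1) hi
  rw [polyFactor]
  linarith

theorem polyTerm_mono (h0 : 0 < q) (h1 : q < 1) : polyTerm q i m ≤ polyTerm q i (m + j) := by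
  have : 0 ≤ 1 - q ^ 2 := by nlinarith
  unfold polyTerm
  refine mul_le_mul_of_nonneg_left ?_ (by positivity)
  refine Finset.prod_le_prod (fun ν _ => by positivity) fun ν _ => ?_
  push_cast
  linarith [Nat.cast_nonneg (α := ℝ) j]

/-- Each factor satisfies `m + j + 2ν ≤ (1 + j/m) (m + 2ν)`, so passing from `m` to `m + j`
multiplies the term by at most `(1 + j/m) ^ i`. -/
theorem polyTerm_add_sub_le (h0 : 0 < q) (h1 : q < 1) (hm : 1 ≤ m) :
    polyTerm q i (m + j) - polyTerm q i m ≤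
      i * ((j : ℝ) / m) * (polyTerm q i m * (1 + (j : ℝ) / m) ^ i) := by
  have hm0 : (0 : ℝ) < m := by exact_mod_cast hm
  have h2 : polyTerm q i (m + j) ≤ (1 + (j : ℝ) / m) ^ i * polyTerm q i m := by
    have : 0 ≤ 1 - q ^ 2 := by nlinarith
    unfold polyTerm
    rw [mul_left_comm]
    refine mul_le_mul_of_nonneg_left ?_ (by positivity)
    conv_rhs => rw [← Finset.card_range i, ← Finset.prod_const, Finset.card_range,
      ← Finset.prod_mul_distrib]
    refine Finset.prod_le_prod (fun ν _ => by positivity) fun ν _ => ?_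
    have : (1 + (j : ℝ) / m) * (m + 2 * ν) = m + j + 2 * ν + 2 * ν * (j / m) := by
      field_simp; ring
    rw [this]
    push_cast
    have : 0 ≤ 2 * (ν : ℝ) * (j / m) := by positivity
    linarith
  have h3 := one_add_pow_sub_one_le (y := (j : ℝ) / m) (by positivity) i
  have h4 := mul_le_mul_of_nonneg_right h3 (polyTerm_nonneg (i := i) (m := m) h0 h1)
  linarith

/-- Here `(1 + j/m) ^ i ≤ e^{l j / m} ≤ e^{(1 - q) j / 2}`, with no constant depending on `l`. This
is the source of the absolute bound on `θ` for large `n - p`. -/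
theorem polyTerm_mul_le_of_large (h0 : 0 < q) (h1 : q < 1) (hm : 1 ≤ m)
    (hl : 2 * (l : ℝ) / (1 - q) ≤ m) (hi : i ∈ Finset.Icc 1 (l - 1)) :
    polyTerm q i m * (1 + (j : ℝ) / m) ^ i ≤ polyTerm q i m * Real.exp ((1 - q) / 2 * j) := by
  have hm0 : (0 : ℝ) < m := by exact_mod_cast hm
  refine mul_le_mul_of_nonneg_left ?_ (polyTerm_nonneg h0 h1)
  have h2 : (1 + (j : ℝ) / m) ^ i ≤ Real.exp (j / m) ^ i := by
    refine pow_le_pow_left₀ (by positivity) ?_ i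
    linarith [Real.add_one_le_exp ((j : ℝ) / m)]
  refine h2.trans ?_
  rw [← Real.exp_nat_mul, Real.exp_le_exp]
  have hil : (i : ℝ) ≤ l := by
    have := (Finset.mem_Icc.mp hi).2
    exact_mod_cast (by omega : i ≤ l)
  rw [div_le_iff₀ (by linarith)] at hl
  rw [mul_div_assoc', div_le_iff₀ hm0]
  nlinarith [Nat.cast_nonneg (α := ℝ) j, mul_le_mul_of_nonneg_right hil (Nat.cast_nonneg (α := ℝ) j)]

/-- Without a lower bound on `m` depending on `q`, the growth `j ^ i` is paid for by the factor `(1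
- q ^ 2) ^ i / i!` inside the term. The power `m ^ i` from the product cancels `(j/m) ^ i` down to
`j ^ i`, and `((1 - q) j / 2) ^ i / i!` is below the exponential. -/
theorem polyTerm_mul_le (h0 : 0 < q) (h1 : q < 1) (hm : 1 ≤ m) (hi : i ∈ Finset.Icc 1 (l - 1)) :
    polyTerm q i m * (1 + (j : ℝ) / m) ^ i ≤
      2 ^ l * (1 + 2 ^ l * (2 * l + 1) ^ l) * (polyFactor q l m * Real.exp ((1 - q) / 2 * j)) := by
  have hm0 : (0 : ℝ) < m := by exact_mod_cast hm
  have hm1 : (1 : ℝ) ≤ m := by exact_mod_cast hm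
  have hil : i ≤ l := by
    have := (Finset.mem_Icc.mp hi).2
    omega
  set X := Real.exp ((1 - q) / 2 * j) with hX
  have hX1 : 1 ≤ X := Real.one_le_exp (mul_nonneg (by linarith) (Nat.cast_nonneg _))
  have hP := one_le_polyFactor (l := l) (m := m) h0 h1
  have hc : (1 - q ^ 2) ^ i / ((i.factorial : ℝ) * 2 ^ i) ≤ (1 - q) ^ i / i.factorial := by
    rw [div_le_div_iff₀ (by positivity) (by positivity)]
    have : (1 - q ^ 2) ^ i ≤ (1 - q) ^ i * 2 ^ i := by
      rw [← mul_pow]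
      exact pow_le_pow_left₀ (by nlinarith) (by nlinarith) i
    nlinarith [mul_le_mul_of_nonneg_right this (Nat.cast_nonneg (α := ℝ) i.factorial)]
  have hprod : ∏ ν ∈ Finset.range i, ((m : ℝ) + 2 * (ν : ℝ)) ≤ (m * (2 * l + 1)) ^ i := by
    have hpow : ((m : ℝ) * (2 * l + 1)) ^ i = ∏ _ν ∈ Finset.range i, ((m : ℝ) * (2 * l + 1)) := by
      rw [Finset.prod_const, Finset.card_range]
    rw [hpow]
    refine Finset.prod_le_prod (fun ν _ => by positivity) fun ν hν => ?_
    have : (ν : ℝ) ≤ l := by exact_mod_cast (by have := Finset.mem_range.mp hν; omega : ν ≤ l)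
    nlinarith
  have h2 : polyTerm q i m * ((j : ℝ) / m) ^ i ≤ 2 ^ l * (2 * l + 1) ^ l * X := by
    have e1 : polyTerm q i m * ((j : ℝ) / m) ^ i ≤
        ((1 - q) ^ i / i.factorial * (m * (2 * l + 1)) ^ i) * ((j : ℝ) / m) ^ i := by
      refine mul_le_mul_of_nonneg_right ?_ (by positivity)
      exact mul_le_mul hc hprod (Finset.prod_nonneg fun ν _ => by positivity)
        (div_nonneg (pow_nonneg (by linarith) _) (Nat.cast_nonneg _))
    have e2 : ((1 - q) ^ i / i.factorial * ((m : ℝ) * (2 * l + 1)) ^ i) * ((j : ℝ) / m) ^ i =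
        2 ^ i * (2 * l + 1) ^ i * (((1 - q) / 2 * j) ^ i / i.factorial) := by
      rw [mul_pow, mul_pow, div_pow, div_pow]
      field_simp
    rw [e2] at e1
    refine e1.trans (mul_le_mul ?_ ?_ ?_ (by positivity))
    · exact mul_le_mul (pow_le_pow_right₀ (by norm_num) hil)
        (pow_le_pow_right₀ (by linarith [Nat.cast_nonneg (α := ℝ) l]) hil) (by positivity)
        (by positivity)
    · exact Real.pow_div_factorial_le_exp _ (mul_nonneg (by linarith) (Nat.cast_nonneg _)) i
    · exact div_nonneg (pow_nonneg (mul_nonneg (by linarith) (Nat.cast_nonneg _)) _)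
        (Nat.cast_nonneg _)
  have h3 : (1 + (j : ℝ) / m) ^ i ≤ 2 ^ l * (1 + ((j : ℝ) / m) ^ i) := by
    have := add_pow_le (zero_le_one' ℝ) (by positivity : 0 ≤ (j : ℝ) / m) i
    rw [one_pow] at this
    refine this.trans (mul_le_mul_of_nonneg_right ?_ (by positivity))
    exact pow_le_pow_right₀ (by norm_num) (by omega)
  have hT := polyTerm_le_polyFactor (m := m) h0 h1 hi
  calc polyTerm q i m * (1 + (j : ℝ) / m) ^ i
      ≤ polyTerm q i m * (2 ^ l * (1 + ((j : ℝ) / m) ^ i)) :=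
        mul_le_mul_of_nonneg_left h3 (polyTerm_nonneg h0 h1)
    _ = 2 ^ l * (polyTerm q i m + polyTerm q i m * ((j : ℝ) / m) ^ i) := by ring
    _ ≤ 2 ^ l * (polyFactor q l m * X + 2 ^ l * (2 * l + 1) ^ l * (polyFactor q l m * X)) := by
        refine mul_le_mul_of_nonneg_left (add_le_add ?_ ?_) (by positivity)
        · nlinarith
        · refine h2.trans (mul_le_mul_of_nonneg_left ?_ (by positivity))
          nlinarith
    _ = _ := by ring

/-- The constant `K` is left free so that the regime of large `m` (`K = 1`) and the general one (`K
= polyConst l`) share all later estimates. -/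
theorem polyFactor_add_sub_le {K : ℝ} (h0 : 0 < q) (h1 : q < 1) (hm : 1 ≤ m)
    (hK : ∑ i ∈ Finset.Icc 1 (l - 1), polyTerm q i m * (1 + (j : ℝ) / m) ^ i ≤
      K * (polyFactor q l m * Real.exp ((1 - q) / 2 * j))) :
    polyFactor q l (m + j) / polyFactor q l m - 1 ≤
      K * l / m * (j * Real.exp ((1 - q) / 2 * j)) := by
  have hm0 : (0 : ℝ) < m := by exact_mod_cast hm
  have hP := one_le_polyFactor (l := l) (m := m) h0 h1
  have hP0 : 0 < polyFactor q l m := by linarith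
  rw [div_sub_one hP0.ne', div_le_iff₀ hP0]
  have h2 : polyFactor q l (m + j) - polyFactor q l m ≤
      l * ((j : ℝ) / m) * ∑ i ∈ Finset.Icc 1 (l - 1), polyTerm q i m * (1 + (j : ℝ) / m) ^ i := by
    rw [polyFactor, polyFactor, add_sub_add_left_eq_sub, ← Finset.sum_sub_distrib, Finset.mul_sum]
    refine Finset.sum_le_sum fun i hi => (polyTerm_add_sub_le h0 h1 hm).trans ?_
    refine mul_le_mul_of_nonneg_right ?_ (mul_nonneg (polyTerm_nonneg h0 h1) (by positivity))
    refine mul_le_mul_of_nonneg_right ?_ (by positivity)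
    have := (Finset.mem_Icc.mp hi).2
    exact_mod_cast (by omega : i ≤ l)
  refine (h2.trans (mul_le_mul_of_nonneg_left hK (by positivity))).trans (le_of_eq ?_)
  ring

/-- From `e^x ≤ 1 / (1 - x)` at `x = (1 - q) / 2` one gets `2 / (1 + q)`, and `4 q ≤ (1 + q) ^ 2`.
Thus the exponential growth turns the ratio `q` into at most `(1 + q) / 2`, which only halves the
distance to `1`. -/
theorem exp_half_one_sub (h0 : 0 < q) (h1 : q < 1) :
    Real.exp ((1 - q) / 2) ≤ 2 ∧ q * Real.exp ((1 - q) / 2) ≤ (1 + q) / 2 := by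
  have h2 := Real.add_one_le_exp (-((1 - q) / 2))
  have h3 : Real.exp ((1 - q) / 2) * Real.exp (-((1 - q) / 2)) = 1 := by
    rw [← Real.exp_add]; simp
  have h4 := Real.exp_pos ((1 - q) / 2)
  have h5 : (1 + q) / 2 * Real.exp ((1 - q) / 2) ≤ 1 := by nlinarith
  refine ⟨by nlinarith, ?_⟩
  have h6 : q ≤ ((1 + q) / 2) * ((1 + q) / 2) := by nlinarith [sq_nonneg (1 - q)]
  nlinarith [mul_le_mul_of_nonneg_right h6 h4.le]

theorem hasSum_succ_mul_geometric {r : ℝ} (h0 : 0 ≤ r) (h1 : r < 1) :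
    HasSum (fun j : ℕ => ((j : ℝ) + 1) * r ^ j) (1 / (1 - r) ^ 2) := by
  have := hasSum_choose_mul_geometric_of_norm_lt_one 1 (r := r) (by rwa [Real.norm_of_nonneg h0])
  convert! this using 1
  funext j
  simp

theorem hasSum_succ_mul_succ_mul_geometric {r : ℝ} (h0 : 0 ≤ r) (h1 : r < 1) :
    HasSum (fun j : ℕ => ((j : ℝ) + 2) * ((j : ℝ) + 1) * r ^ j) (2 / (1 - r) ^ 3) := by
  have := (hasSum_choose_mul_geometric_of_norm_lt_one 2 (r := r)
    (by rwa [Real.norm_of_nonneg h0])).mul_left 2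
  convert! this using 1
  · funext j
    rw [Nat.cast_choose_two]
    push_cast
    ring
  · ring

/-- Bounding the integer minimum by `p` leaves a sum equal to `1 / (1 - r) ^ 2`; bounding it by `j +
2` leaves `2 / (1 - r) ^ 3`. The better of the two gives the real minimum on the right. -/
theorem summable_and_tsum_min_mul_le {r : ℝ} (h0 : 0 ≤ r) (h1 : r < 1) (p : ℕ) :
    Summable (fun j : ℕ => ((min (j + 2) p : ℕ) : ℝ) * (((j : ℝ) + 1) * r ^ j)) ∧
      ∑' j : ℕ, ((min (j + 2) p : ℕ) : ℝ) * (((j : ℝ) + 1) * r ^ j) ≤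
        2 / (1 - r) ^ 2 * min (p : ℝ) (1 / (1 - r)) := by
  have hA := hasSum_succ_mul_geometric h0 h1
  have hB := hasSum_succ_mul_succ_mul_geometric h0 h1
  have hle : ∀ j : ℕ, ((min (j + 2) p : ℕ) : ℝ) * (((j : ℝ) + 1) * r ^ j) ≤
      p * (((j : ℝ) + 1) * r ^ j) := fun j =>
    mul_le_mul_of_nonneg_right (by exact_mod_cast min_le_right _ _) (by positivity)
  have hle' : ∀ j : ℕ, ((min (j + 2) p : ℕ) : ℝ) * (((j : ℝ) + 1) * r ^ j) ≤
      ((j : ℝ) + 2) * ((j : ℝ) + 1) * r ^ j := fun j => by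
    rw [mul_assoc]
    exact mul_le_mul_of_nonneg_right (by exact_mod_cast min_le_left _ _) (by positivity)
  have hs := Summable.of_nonneg_of_le (fun j => by positivity) hle (hA.summable.mul_left (p : ℝ))
  refine ⟨hs, ?_⟩
  have hr : 0 < 1 - r := by linarith
  rcases min_cases (p : ℝ) (1 / (1 - r)) with h | h
  · rw [h.1]
    have := hs.tsum_le_tsum hle (hA.summable.mul_left (p : ℝ))
    rw [tsum_mul_left, hA.tsum_eq] at this
    refine this.trans ?_
    have : 0 ≤ (p : ℝ) * (1 / (1 - r) ^ 2) := by positivity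
    calc (p : ℝ) * (1 / (1 - r) ^ 2) ≤ 2 * ((p : ℝ) * (1 / (1 - r) ^ 2)) := by linarith
      _ = _ := by ring
  · rw [h.1]
    have := hs.tsum_le_tsum hle' hB.summable
    rw [hB.tsum_eq] at this
    refine this.trans (le_of_eq ?_)
    field_simp

theorem summable_and_tsum_le_of_le {K : ℝ} {p : ℕ} {d : ℕ → ℝ} (h0 : 0 < q) (h1 : q < 1)
    (hK : 0 ≤ K) (hd0 : ∀ j, 0 ≤ d j)
    (hd : ∀ j : ℕ, d j ≤ K * (j * Real.exp ((1 - q) / 2 * j))) :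
    Summable (fun j : ℕ => ((min (j + 1) p : ℕ) : ℝ) * (q ^ j * d j)) ∧
      ∑' j : ℕ, ((min (j + 1) p : ℕ) : ℝ) * (q ^ j * d j) ≤
        32 * K * q / (1 - q) ^ 2 * min (p : ℝ) (1 / (1 - q)) := by
  obtain ⟨hs, ht⟩ := summable_and_tsum_min_mul_le (r := (1 + q) / 2) (by linarith) (by linarith) p
  obtain ⟨hρ, hρq⟩ := exp_half_one_sub h0 h1
  set ρ := Real.exp ((1 - q) / 2) with hρd
  have hρ0 : 0 < ρ := Real.exp_pos _
  -- The term `j = 0` vanishes, so the sum starts at `j = 1`; this supplies the factor `q` in the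
  -- bound.
  have hd00 : d 0 = 0 := le_antisymm (by simpa using hd 0) (hd0 0)
  have hle : ∀ j : ℕ, ((min (j + 1 + 1) p : ℕ) : ℝ) * (q ^ (j + 1) * d (j + 1)) ≤
      2 * K * q * (((min (j + 2) p : ℕ) : ℝ) * (((j : ℝ) + 1) * ((1 + q) / 2) ^ j)) := by
    intro j
    rw [mul_left_comm (2 * K * q)]
    refine mul_le_mul_of_nonneg_left ?_ (Nat.cast_nonneg _)
    have h2 := mul_le_mul_of_nonneg_left (hd (j + 1)) (by positivity : 0 ≤ q ^ (j + 1))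
    refine h2.trans ?_
    rw [mul_comm _ (((j + 1 : ℕ) : ℝ)), Real.exp_nat_mul]
    have h3 : q ^ (j + 1) * ρ ^ (j + 1) ≤ 2 * q * ((1 + q) / 2) ^ j := by
      have h4 : (q * ρ) ^ j ≤ ((1 + q) / 2) ^ j := pow_le_pow_left₀ (by positivity) hρq j
      calc q ^ (j + 1) * ρ ^ (j + 1) = (ρ * q) * (q * ρ) ^ j := by ring
        _ ≤ (2 * q) * ((1 + q) / 2) ^ j :=
          mul_le_mul (mul_le_mul_of_nonneg_right hρ h0.le) h4 (by positivity) (by positivity)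
    push_cast
    calc q ^ (j + 1) * (K * (((j : ℝ) + 1) * ρ ^ (j + 1)))
        = (K * ((j : ℝ) + 1)) * (q ^ (j + 1) * ρ ^ (j + 1)) := by ring
      _ ≤ (K * ((j : ℝ) + 1)) * (2 * q * ((1 + q) / 2) ^ j) :=
        mul_le_mul_of_nonneg_left h3 (by positivity)
      _ = _ := by ring
  have hs1 : Summable (fun j : ℕ => ((min (j + 1 + 1) p : ℕ) : ℝ) * (q ^ (j + 1) * d (j + 1))) :=
    Summable.of_nonneg_of_le (fun j => mul_nonneg (Nat.cast_nonneg _)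
      (mul_nonneg (by positivity) (hd0 _))) hle (hs.mul_left _)
  have hs2 : Summable (fun j : ℕ => ((min (j + 1) p : ℕ) : ℝ) * (q ^ j * d j)) :=
    (summable_nat_add_iff 1).mp hs1
  refine ⟨hs2, ?_⟩
  rw [hs2.tsum_eq_zero_add, hd00, mul_zero, mul_zero, zero_add]
  refine (hs1.tsum_le_tsum hle (hs.mul_left _)).trans ?_
  rw [tsum_mul_left]
  refine (mul_le_mul_of_nonneg_left ht (by positivity)).trans ?_
  have hq : 0 < 1 - q := by linarith
  have e1 : 1 - (1 + q) / 2 = (1 - q) / 2 := by ring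
  have e2 : min (p : ℝ) (1 / (1 - (1 + q) / 2)) ≤ 2 * min (p : ℝ) (1 / (1 - q)) := by
    rw [e1]
    have e3 : 1 / ((1 - q) / 2) = 2 * (1 / (1 - q)) := by field_simp
    rcases min_cases (p : ℝ) (1 / (1 - q)) with h | h
    · rw [h.1]
      exact (min_le_left _ _).trans (by linarith [Nat.cast_nonneg (α := ℝ) p])
    · rw [h.1, ← e3]
      exact min_le_right _ _
  rw [e1] at e2 ⊢
  -- The constant is `32 = 2 * 2 * 4 * 2`: the bound on `ρ`, the preceding series bound, the squared
  -- halving of `1 - q`, and the halving inside the minimum.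
  calc 2 * K * q * (2 / ((1 - q) / 2) ^ 2 * min (p : ℝ) (1 / ((1 - q) / 2)))
      ≤ 2 * K * q * (2 / ((1 - q) / 2) ^ 2 * (2 * min (p : ℝ) (1 / (1 - q)))) := by gcongr
    _ = _ := by
      field_simp
      ring

theorem polyFactor_add_sub_nonneg (h0 : 0 < q) (h1 : q < 1) :
    0 ≤ polyFactor q l (m + j) / polyFactor q l m - 1 := by
  have hP := one_le_polyFactor (l := l) (m := m) h0 h1
  rw [sub_nonneg, one_le_div (by linarith), polyFactor, polyFactor, add_le_add_iff_left]
  exact Finset.sum_le_sum fun i _ => polyTerm_mono h0 h1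

/-- A bound, depending only on `l`, for the oscillation of the polynomial factor of `ψ_l`. -/
noncomputable def polyConst (l : ℕ) : ℝ := l * (2 ^ l * (1 + 2 ^ l * (2 * l + 1) ^ l))

theorem sum_polyTerm_mul_le (h0 : 0 < q) (h1 : q < 1) (hm : 1 ≤ m) :
    ∑ i ∈ Finset.Icc 1 (l - 1), polyTerm q i m * (1 + (j : ℝ) / m) ^ i ≤
      polyConst l * (polyFactor q l m * Real.exp ((1 - q) / 2 * j)) := by
  have hP := one_le_polyFactor (l := l) (m := m) h0 h1
  refine (Finset.sum_le_card_nsmul _ _ _ fun i hi =>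
    polyTerm_mul_le (j := j) h0 h1 hm hi).trans ?_
  rw [nsmul_eq_mul, polyConst, mul_assoc (l : ℝ), Nat.card_Icc]
  refine mul_le_mul_of_nonneg_right ?_ ?_
  · exact_mod_cast (by omega : l - 1 + 1 - 1 ≤ l)
  · exact mul_nonneg (by positivity) (mul_nonneg (by linarith) (Real.exp_pos _).le)

theorem sum_polyTerm_mul_le_of_large (h0 : 0 < q) (h1 : q < 1) (hm : 1 ≤ m)
    (hl : 2 * (l : ℝ) / (1 - q) ≤ m) :
    ∑ i ∈ Finset.Icc 1 (l - 1), polyTerm q i m * (1 + (j : ℝ) / m) ^ i ≤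
      1 * (polyFactor q l m * Real.exp ((1 - q) / 2 * j)) := by
  refine (Finset.sum_le_sum fun i hi => polyTerm_mul_le_of_large h0 h1 hm hl hi).trans ?_
  rw [← Finset.sum_mul, one_mul]
  refine mul_le_mul_of_nonneg_right ?_ (Real.exp_pos _).le
  rw [polyFactor]
  linarith

theorem polyPsi_ratio_bound {K : ℝ} (hK : 0 ≤ K) (h0 : 0 < q) (h1 : q < 1) (hm : 1 ≤ m)
    (hsum : ∀ j : ℕ, ∑ i ∈ Finset.Icc 1 (l - 1), polyTerm q i m * (1 + (j : ℝ) / m) ^ i ≤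
      K * (polyFactor q l m * Real.exp ((1 - q) / 2 * j))) (p : ℕ) :
    Summable (fun j : ℕ => ((min (j + 1) p : ℕ) : ℝ) *
      (q ^ j * (polyFactor q l (m + j) / polyFactor q l m - 1))) ∧
    ∑' j : ℕ, ((min (j + 1) p : ℕ) : ℝ) *
      (q ^ j * (polyFactor q l (m + j) / polyFactor q l m - 1)) ≤
      32 * K * (l * q / (m * (1 - q) ^ 2) * min (p : ℝ) (1 / (1 - q))) := by
  have hm0 : (0 : ℝ) < m := by exact_mod_cast hm
  obtain ⟨h2, h3⟩ := summable_and_tsum_le_of_le (p := p) (K := K * l / m) h0 h1 (by positivity)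
    (fun j => polyFactor_add_sub_nonneg h0 h1) fun j => polyFactor_add_sub_le h0 h1 hm (hsum j)
  refine ⟨h2, h3.trans (le_of_eq ?_)⟩
  have : 0 < 1 - q := by linarith
  field_simp

end polyFactor

/-! ### Norms of modulated functions and averaging over the phase. -/

/-- On the circle, the set where a continuous function exceeds its essential supremum is open and
null, hence empty. -/
theorem norm_le_eLpNorm_top {E : Type*} [NormedAddCommGroup E] [SecondCountableTopology E]
    {h : ℝ → E} (hp : Function.Periodic h (2 * Real.pi)) (hc : Continuous h) (t : ℝ) :
    ‖h t‖ ≤ (eLpNorm h ∞ periodMeasure).toReal := by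
  have : Fact (0 < 2 * Real.pi) := ⟨Real.two_pi_pos⟩
  obtain ⟨H, hH⟩ := exists_addCircle_lift hp hc
  have h2 : h = H ∘ ((↑) : ℝ → AddCircle (2 * Real.pi)) := by
    funext t; simp [← hH]
  have hfin := (memLp_of_continuous_periodic hp hc ∞).eLpNorm_ne_top
  have h3 : eLpNorm h ∞ periodMeasure = eLpNorm H ∞ volume := by
    conv_lhs => rw [h2]
    exact eLpNorm_comp_measurePreserving (by fun_prop) measurePreserving_addCircle_mk
  rw [h3] at hfin ⊢
  have h4 : ∀ᵐ y, ‖H y‖ₑ ≤ eLpNorm H ∞ volume := by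
    rw [eLpNorm_exponent_top]; exact ae_le_eLpNormEssSup
  have h5 : {y | ¬ ‖H y‖ₑ ≤ eLpNorm H ∞ volume} = ∅ := by
    refine (IsOpen.measure_eq_zero_iff volume ?_).mp h4
    simp only [not_le]
    exact isOpen_lt continuous_const (by fun_prop)
  have h6 : ‖H t‖ₑ ≤ eLpNorm H ∞ volume := by
    by_contra hcon
    have : (t : AddCircle (2 * Real.pi)) ∈ {y | ¬ ‖H y‖ₑ ≤ eLpNorm H ∞ volume} := hcon
    rw [h5] at this
    exact this
  rw [← hH, ← toReal_enorm]
  exact ENNReal.toReal_mono hfin h6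

theorem lsNorm_le_add {u : ℝ≥0∞} (hu : 1 ≤ u) {f h : ℝ → ℝ} (hf : MemLp f u periodMeasure)
    (hh : MemLp h u periodMeasure) : lsNorm u f ≤ lsNorm u h + lsNorm u (fun t => f t - h t) := by
  have h1 := eLpNorm_add_le hh.1 (hf.sub hh).1 hu
  rw [add_sub_cancel] at h1
  have e : (fun t => f t - h t) = f - h := rfl
  rw [lsNorm, lsNorm, lsNorm, e, ← ENNReal.toReal_add hh.eLpNorm_ne_top (hf.sub hh).eLpNorm_ne_top]
  exact ENNReal.toReal_mono (ENNReal.add_ne_top.mpr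
    ⟨hh.eLpNorm_ne_top, (hf.sub hh).eLpNorm_ne_top⟩) h1

theorem lsNorm_sub_comm (u : ℝ≥0∞) (f h : ℝ → ℝ) :
    lsNorm u (fun t => f t - h t) = lsNorm u (fun t => h t - f t) := by
  rw [lsNorm, lsNorm]
  congr 1
  exact eLpNorm_sub_comm f h u periodMeasure

theorem abs_lsNorm_sub_le {u : ℝ≥0∞} (hu : 1 ≤ u) {f h : ℝ → ℝ} (hf : MemLp f u periodMeasure)
    (hh : MemLp h u periodMeasure) : |lsNorm u f - lsNorm u h| ≤ lsNorm u (fun t => f t - h t) := by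
  rw [abs_le]
  have h1 := lsNorm_le_add hu hf hh
  have h2 := lsNorm_le_add hu hh hf
  rw [lsNorm_sub_comm] at h2
  constructor <;> linarith

/-- Since `2π ≥ 1` and `1/u ≤ 1`, the factor `(2π)^{1/u}` is at most `2π`, uniformly in `u`. -/
theorem toReal_eLpNorm_le_of_bound {E : Type*} [NormedAddCommGroup E] {u : ℝ≥0∞} (hu : 1 ≤ u)
    {h : ℝ → E} {B : ℝ} (hB0 : 0 ≤ B) (hB : ∀ t, ‖h t‖ ≤ B) :
    (eLpNorm h u periodMeasure).toReal ≤ 2 * Real.pi * B := by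
  have h1 : (1 : ℝ) ≤ 2 * Real.pi := by linarith [Real.two_le_pi]
  have h2 := eLpNorm_le_of_ae_bound (p := u) (μ := periodMeasure) (Filter.Eventually.of_forall hB)
  have h3 : u.toReal⁻¹ ≤ 1 := by
    rcases eq_or_ne u ∞ with rfl | htop
    · simp
    · exact inv_le_one_of_one_le₀ (by simpa using ENNReal.toReal_mono htop hu)
  rw [periodMeasure_univ] at h2
  have h4 : ENNReal.ofReal (2 * Real.pi) ^ u.toReal⁻¹ * ENNReal.ofReal B ≤
      ENNReal.ofReal (2 * Real.pi * B) := by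
    rw [ENNReal.ofReal_mul (p := 2 * Real.pi) (by positivity)]
    have h5 : ENNReal.ofReal (2 * Real.pi) ^ u.toReal⁻¹ ≤ ENNReal.ofReal (2 * Real.pi) := by
      calc ENNReal.ofReal (2 * Real.pi) ^ u.toReal⁻¹ ≤ ENNReal.ofReal (2 * Real.pi) ^ (1 : ℝ) :=
          ENNReal.rpow_le_rpow_of_exponent_le (by rwa [ENNReal.one_le_ofReal]) h3
        _ = _ := ENNReal.rpow_one _
    gcongr
  exact ENNReal.toReal_le_of_le_ofReal (by positivity) (h2.trans h4)

/-- The `L_u` norm of `cos (m t + τ + arg g t) |g t|` averaged over the phase `τ`. -/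
noncomputable def phaseMean (u : ℝ≥0∞) (g : ℝ → ℂ) : ℝ :=
  ((2 * Real.pi) ^ (u⁻¹).toReal)⁻¹ * lsNorm u Real.cos * (eLpNorm g u periodMeasure).toReal

/-- The real part of `e^{i (m t + γ)} g t`. -/
noncomputable def modulated (m : ℕ) (γ : ℝ) (g : ℝ → ℂ) (t : ℝ) : ℝ :=
  (Complex.exp ((m * t + γ : ℝ) * Complex.I) * g t).re

theorem modulated_eq_norm_mul_cos (m : ℕ) (γ : ℝ) (g : ℝ → ℂ) (t : ℝ) :
    modulated m γ g t = ‖g t‖ * Real.cos (γ + (m * t + Complex.arg (g t))) := by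
  rw [modulated]
  conv_lhs => rw [← Complex.norm_mul_exp_arg_mul_I (g t)]
  rw [mul_left_comm, ← Complex.exp_add, ← add_mul, ← Complex.ofReal_add, Complex.re_ofReal_mul,
    Complex.exp_ofReal_mul_I_re]
  ring_nf

theorem abs_modulated_le (m : ℕ) (γ : ℝ) (g : ℝ → ℂ) (t : ℝ) : |modulated m γ g t| ≤ ‖g t‖ := by
  rw [modulated_eq_norm_mul_cos]
  exact (abs_mul_cos_le _ _).trans (le_of_eq (abs_norm _))

theorem continuous_modulated {g : ℝ → ℂ} (hc : Continuous g) (m : ℕ) :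
    Continuous fun x : ℝ × ℝ => modulated m x.1 g x.2 := by
  unfold modulated; fun_prop

theorem modulated_memC {g : ℝ → ℂ} (hp : Function.Periodic g (2 * Real.pi)) (hc : Continuous g)
    (m : ℕ) (γ : ℝ) : MemC (modulated m γ g) := by
  refine ⟨fun t => ?_, (continuous_modulated hc m).comp (by fun_prop : Continuous fun t => (γ, t))⟩
  rw [modulated_eq_norm_mul_cos, modulated_eq_norm_mul_cos, hp t,
    show γ + (m * (t + 2 * Real.pi) + Complex.arg (g t)) =
      γ + (m * t + Complex.arg (g t)) + m * (2 * Real.pi) by ring, Real.cos_add_nat_mul_two_pi]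

/-- By Tonelli the phase is integrated first; for fixed `t` the integral of `|cos (τ + x)| ^ r` over
a period does not depend on `x`, so `arg (g t)` disappears. -/
theorem lintegral_lintegral_modulated {g : ℝ → ℂ} (hc : Continuous g) (m : ℕ) (γ : ℝ) {r : ℝ}
    (hr : 0 < r) :
    ∫⁻ τ, ∫⁻ t, ‖modulated m (γ + τ) g t‖ₑ ^ r ∂periodMeasure ∂periodMeasure =
      (∫⁻ t, ‖g t‖ₑ ^ r ∂periodMeasure) * ∫⁻ t, ‖Real.cos t‖ₑ ^ r ∂periodMeasure := by
  have hm : Measurable fun x : ℝ × ℝ => ‖modulated m (γ + x.1) g x.2‖ₑ ^ r := by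
    have : Continuous fun x : ℝ × ℝ => modulated m (γ + x.1) g x.2 :=
      (continuous_modulated hc m).comp (by fun_prop : Continuous fun x : ℝ × ℝ => (γ + x.1, x.2))
    exact this.measurable.enorm.pow_const r
  rw [lintegral_lintegral_swap hm.aemeasurable]
  have hcos : ∀ x, ∫⁻ τ, ‖Real.cos (τ + x)‖ₑ ^ r ∂periodMeasure =
      ∫⁻ t, ‖Real.cos t‖ₑ ^ r ∂periodMeasure := by
    intro x
    have h := eLpNorm_add_right Real.cos_periodic Real.continuous_cos (ENNReal.ofReal r) x
    have h0 : ENNReal.ofReal r ≠ 0 := by simpa using hr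
    rw [eLpNorm_eq_lintegral_rpow_enorm_toReal h0 ENNReal.ofReal_ne_top,
      eLpNorm_eq_lintegral_rpow_enorm_toReal h0 ENNReal.ofReal_ne_top,
      ENNReal.toReal_ofReal hr.le] at h
    exact (ENNReal.rpow_left_injective (by positivity)) h
  have : ∀ t, ∫⁻ τ, ‖modulated m (γ + τ) g t‖ₑ ^ r ∂periodMeasure =
      ‖g t‖ₑ ^ r * ∫⁻ t, ‖Real.cos t‖ₑ ^ r ∂periodMeasure := by
    intro t
    rw [← hcos (γ + (m * t + Complex.arg (g t))), ← lintegral_const_mul]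
    · refine lintegral_congr fun τ => ?_
      rw [modulated_eq_norm_mul_cos, enorm_mul, enorm_norm, ENNReal.mul_rpow_of_nonneg _ _ hr.le]
      ring_nf
    · exact (Continuous.measurable (by fun_prop)).enorm.pow_const r
  simp_rw [this]
  rw [lintegral_mul_const _ (hc.measurable.enorm.pow_const r)]

/-- `phaseMean u g` is the `u`-th root of the mean over `τ` of the `u`-th power of the norm, and a
function takes values on both sides of its mean. -/
theorem exists_lsNorm_modulated_le_ge_of_ne_top {g : ℝ → ℂ}
    (hc : Continuous g) (m : ℕ) (γ : ℝ) {u : ℝ≥0∞} (hu : 1 ≤ u) (hut : u ≠ ∞)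
    (hp : Function.Periodic g (2 * Real.pi)) :
    (∃ τ ∈ Ioc 0 (2 * Real.pi), lsNorm u (modulated m (γ + τ) g) ≤ phaseMean u g) ∧
      ∃ τ ∈ Ioc 0 (2 * Real.pi), phaseMean u g ≤ lsNorm u (modulated m (γ + τ) g) := by
  have hu0 : u ≠ 0 := (zero_lt_one.trans_le hu).ne'
  have hr : 0 < u.toReal := ENNReal.toReal_pos hu0 hut
  set r := u.toReal with hrd
  set b : ℝ → ℝ≥0∞ := fun τ => ∫⁻ t, ‖modulated m (γ + τ) g t‖ₑ ^ r ∂periodMeasure with hb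
  have hbm : Measurable b := by
    have : Continuous fun x : ℝ × ℝ => modulated m (γ + x.1) g x.2 :=
      (continuous_modulated hc m).comp (by fun_prop : Continuous fun x : ℝ × ℝ => (γ + x.1, x.2))
    exact (this.measurable.enorm.pow_const r).lintegral_prod_right'
  have hB : ∀ τ, eLpNorm (modulated m (γ + τ) g) u periodMeasure = b τ ^ (1 / r) := fun τ =>
    eLpNorm_eq_lintegral_rpow_enorm_toReal hu0 hut
  have hfin : ∀ τ, b τ ^ (1 / r) ≠ ∞ := fun τ => by
    rw [← hB]
    exact (memLp_of_continuous_periodic (modulated_memC hp hc m _).1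
      (modulated_memC hp hc m _).2 u).eLpNorm_ne_top
  have hcf : eLpNorm Real.cos u periodMeasure ≠ ∞ :=
    (memLp_of_continuous_periodic Real.cos_periodic Real.continuous_cos u).eLpNorm_ne_top
  have hgf : eLpNorm g u periodMeasure ≠ ∞ := (memLp_of_continuous_periodic hp hc u).eLpNorm_ne_top
  have hM : phaseMean u g = ((⨍⁻ τ in Ioc 0 (2 * Real.pi), b τ ∂volume) ^ (1 / r)).toReal := by
    rw [setLAverage_eq]
    have h1 := lintegral_lintegral_modulated hc m γ hr
    have h2 : ∫⁻ τ in Ioc 0 (2 * Real.pi), b τ = ∫⁻ τ, b τ ∂periodMeasure := rfl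
    rw [h2, hb, h1, Real.volume_Ioc, sub_zero, ENNReal.div_rpow_of_nonneg _ _ (by positivity),
      ENNReal.mul_rpow_of_nonneg _ _ (by positivity), phaseMean, lsNorm,
      eLpNorm_eq_lintegral_rpow_enorm_toReal hu0 hut,
      eLpNorm_eq_lintegral_rpow_enorm_toReal hu0 hut, ENNReal.toReal_div, ENNReal.toReal_mul,
      ← ENNReal.toReal_rpow (ENNReal.ofReal _), ENNReal.toReal_ofReal Real.two_pi_pos.le,
      ENNReal.toReal_inv, ← hrd, one_div]
    ring
  have hv0 : volume (Ioc 0 (2 * Real.pi)) ≠ 0 := by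
    rw [Real.volume_Ioc, sub_zero]; simpa using Real.pi_pos
  have hv1 : volume (Ioc 0 (2 * Real.pi)) ≠ ∞ := by
    rw [Real.volume_Ioc]; exact ENNReal.ofReal_ne_top
  have hbi : ∫⁻ τ in Ioc 0 (2 * Real.pi), b τ ≠ ∞ := by
    have h2 : ∫⁻ τ in Ioc 0 (2 * Real.pi), b τ = ∫⁻ τ, b τ ∂periodMeasure := rfl
    rw [h2, hb, lintegral_lintegral_modulated hc m γ hr]
    rw [eLpNorm_eq_lintegral_rpow_enorm_toReal hu0 hut] at hcf hgf
    refine ENNReal.mul_ne_top ?_ ?_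
    · intro h; rw [← hrd, h, ENNReal.top_rpow_of_pos (by positivity)] at hgf; exact hgf rfl
    · intro h; rw [← hrd, h, ENNReal.top_rpow_of_pos (by positivity)] at hcf; exact hcf rfl
  have hav : (⨍⁻ τ in Ioc 0 (2 * Real.pi), b τ ∂volume) ^ (1 / r) ≠ ∞ := by
    refine ENNReal.rpow_ne_top_of_nonneg (by positivity) ?_
    rw [setLAverage_eq]
    exact ENNReal.div_ne_top hbi hv0
  obtain ⟨τ₁, h1, h1'⟩ := exists_le_setLAverage hv0 hv1 hbm.aemeasurable
  obtain ⟨τ₂, h2, h2'⟩ := exists_setLAverage_le hv0 measurableSet_Ioc.nullMeasurableSet hbi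
  refine ⟨⟨τ₁, h1, ?_⟩, τ₂, h2, ?_⟩
  · rw [hM, lsNorm, hB]
    exact ENNReal.toReal_mono hav (ENNReal.rpow_le_rpow h1' (by positivity))
  · rw [hM, lsNorm, hB]
    exact ENNReal.toReal_mono (hfin _) (ENNReal.rpow_le_rpow h2' (by positivity))

theorem phaseMean_top (g : ℝ → ℂ) : phaseMean ∞ g = (eLpNorm g ∞ periodMeasure).toReal := by
  have h1 : lsNorm ∞ Real.cos = 1 := by
    refine le_antisymm ?_ ?_
    · rw [lsNorm, eLpNorm_exponent_top]
      refine ENNReal.toReal_le_of_le_ofReal zero_le_one (eLpNormEssSup_le_of_ae_bound ?_)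
      exact Filter.Eventually.of_forall fun t => Real.abs_cos_le_one t
    · have := norm_le_eLpNorm_top Real.cos_periodic Real.continuous_cos 0
      simpa [lsNorm] using this
  simp [phaseMean, h1]

theorem exists_lsNorm_modulated_le_ge {g : ℝ → ℂ} (hp : Function.Periodic g (2 * Real.pi))
    (hc : Continuous g) (m : ℕ) (γ : ℝ) {u : ℝ≥0∞} (hu : 1 ≤ u) :
    (∃ τ ∈ Icc 0 (2 * Real.pi), lsNorm u (modulated m (γ + τ) g) ≤ phaseMean u g) ∧
      ∃ τ ∈ Icc 0 (2 * Real.pi), phaseMean u g ≤ lsNorm u (modulated m (γ + τ) g) := by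
  rcases eq_or_ne u ∞ with rfl | hut
  · rw [phaseMean_top]
    have hgf := (memLp_of_continuous_periodic hp hc ∞).eLpNorm_ne_top
    refine ⟨⟨0, ⟨le_rfl, Real.two_pi_pos.le⟩, ?_⟩, ?_⟩
    · exact ENNReal.toReal_mono hgf (eLpNorm_mono fun t => abs_modulated_le _ _ _ _)
    · obtain ⟨t₀, -, ht₀⟩ := (isCompact_Icc (a := (0 : ℝ)) (b := 2 * Real.pi)).exists_isMaxOn
        ⟨0, ⟨le_rfl, Real.two_pi_pos.le⟩⟩ hc.norm.continuousOn
      have hmax : (eLpNorm g ∞ periodMeasure).toReal ≤ ‖g t₀‖ := by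
        rw [eLpNorm_exponent_top]
        refine ENNReal.toReal_le_of_le_ofReal (norm_nonneg _) (eLpNormEssSup_le_of_ae_bound ?_)
        rw [periodMeasure]
        filter_upwards [ae_restrict_mem measurableSet_Ioc] with t ht
        exact ht₀ (Ioc_subset_Icc_self ht)
      -- This phase puts a crest of the cosine at the maximum point of `|g|`; it is then reduced
      -- modulo `2π`.
      set x := -(γ + (m * t₀ + Complex.arg (g t₀))) with hx
      refine ⟨toIcoMod Real.two_pi_pos 0 x, ?_, ?_⟩
      · have := toIcoMod_mem_Ico Real.two_pi_pos 0 x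
        rw [zero_add] at this
        exact ⟨this.1, this.2.le⟩
      · refine hmax.trans ?_
        have h1 := modulated_memC hp hc m (γ + toIcoMod Real.two_pi_pos 0 x)
        refine le_trans (le_of_eq ?_) (norm_le_eLpNorm_top h1.1 h1.2 t₀)
        have h2 : γ + toIcoMod Real.two_pi_pos 0 x + (m * t₀ + Complex.arg (g t₀)) =
            0 - toIcoDiv Real.two_pi_pos 0 x * (2 * Real.pi) := by
          rw [toIcoMod, zsmul_eq_mul, hx]; ring
        rw [modulated_eq_norm_mul_cos, h2, Real.cos_sub_int_mul_two_pi, Real.cos_zero, mul_one,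
          norm_norm]
  · obtain ⟨⟨a, ha, ha'⟩, b, hb, hb'⟩ := exists_lsNorm_modulated_le_ge_of_ne_top hc m γ hu hut hp
    exact ⟨⟨a, Ioc_subset_Icc_self ha, ha'⟩, b, Ioc_subset_Icc_self hb, hb'⟩

/-- Translating `t` by `τ / m` keeps the norm and advances the carrier by the phase `τ`, so it
differs from a pure phase change only through `g (t + τ / m) - g t`. The phase mean lies between the
norms for two phases, each within `D` of the given one. -/
theorem abs_lsNorm_modulated_sub_le {g : ℝ → ℂ} (hp : Function.Periodic g (2 * Real.pi))
    (hc : Continuous g) {m : ℕ} (hm : 1 ≤ m) (γ : ℝ) {u : ℝ≥0∞} (hu : 1 ≤ u) {D : ℝ}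
    (hD : ∀ τ ∈ Icc 0 (2 * Real.pi / m),
      (eLpNorm (fun t => g (t + τ) - g t) u periodMeasure).toReal ≤ D) :
    |lsNorm u (modulated m γ g) - phaseMean u g| ≤ D := by
  have hm0 : (0 : ℝ) < m := by exact_mod_cast hm
  have key : ∀ τ ∈ Icc 0 (2 * Real.pi),
      |lsNorm u (modulated m γ g) - lsNorm u (modulated m (γ + τ) g)| ≤ D := by
    intro τ hτ
    have h1 := modulated_memC hp hc m γ
    have h2 := modulated_memC hp hc m (γ + τ)
    have e1 : lsNorm u (modulated m γ g) = lsNorm u fun t => modulated m γ g (t + τ / m) := by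
      rw [lsNorm, lsNorm, eLpNorm_add_right h1.1 h1.2]
    have h3 : MemLp (fun t => modulated m γ g (t + τ / m)) u periodMeasure := by
      refine memLp_of_continuous_periodic (fun t => ?_) (h1.2.comp (by fun_prop)) u
      simp only [Function.comp_apply]
      rw [add_right_comm, h1.1]
    rw [e1]
    refine (abs_lsNorm_sub_le hu h3 (memLp_of_continuous_periodic h2.1 h2.2 u)).trans ?_
    refine le_trans ?_ (hD (τ / m) ⟨div_nonneg hτ.1 hm0.le, by gcongr; exact hτ.2⟩)
    have h4 : MemLp (fun t => g (t + τ / m) - g t) u periodMeasure := by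
      refine memLp_of_continuous_periodic (fun t => ?_) (by fun_prop) u
      rw [add_right_comm, hp, hp]
    refine ENNReal.toReal_mono h4.eLpNorm_ne_top (eLpNorm_mono fun t => ?_)
    have : modulated m γ g (t + τ / m) - modulated m (γ + τ) g t =
        modulated m (γ + τ) (fun t => g (t + τ / m) - g t) t := by
      simp only [modulated, mul_sub, Complex.sub_re]
      congr 6
      field_simp
      ring
    rw [this]
    exact abs_modulated_le _ _ _ _
  obtain ⟨⟨τ₁, h1, h1'⟩, τ₂, h2, h2'⟩ := exists_lsNorm_modulated_le_ge hp hc m γ hu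
  have k1 := abs_le.mp (key τ₁ h1)
  have k2 := abs_le.mp (key τ₂ h2)
  rw [abs_le]
  constructor <;> linarith [k1.1, k1.2, k2.1, k2.2]

/-- By `(Re w)² = |w|² / 2 + Re (w²) / 2`, the phase enters the squared norm only through the
integral assumed to vanish. The norm is thus the same for all phases, hence equal to its mean. -/
theorem lsNorm_two_modulated_eq {g : ℝ → ℂ} (hp : Function.Periodic g (2 * Real.pi))
    (hc : Continuous g) (m : ℕ) (γ : ℝ)
    (h0 : ∫ t : ℝ, Complex.exp ((2 * (m * t) : ℝ) * Complex.I) * g t ^ 2 ∂periodMeasure = 0) :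
    lsNorm 2 (modulated m γ g) = phaseMean 2 g := by
  have key : ∀ γ, lsNorm 2 (modulated m γ g) =
      (∫ t, ‖g t‖ ^ 2 / 2 ∂periodMeasure) ^ ((2 : ℝ)⁻¹) := by
    intro γ
    have h1 := modulated_memC hp hc m γ
    rw [lsNorm, (memLp_of_continuous_periodic h1.1 h1.2 2).eLpNorm_eq_integral_rpow_norm
      (by norm_num) (by norm_num), ENNReal.toReal_ofReal (by positivity)]
    simp only [ENNReal.toReal_ofNat, Real.rpow_two, Real.norm_eq_abs, sq_abs]
    congr 1
    have h2 : ∀ t, modulated m γ g t ^ 2 = ‖g t‖ ^ 2 / 2 +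
        (Complex.exp ((2 * γ : ℝ) * Complex.I) / 2 *
          (Complex.exp ((2 * (m * t) : ℝ) * Complex.I) * g t ^ 2)).re := by
      intro t
      set w := Complex.exp ((m * t + γ : ℝ) * Complex.I) * g t with hw
      have e1 : Complex.exp ((2 * γ : ℝ) * Complex.I) / 2 *
          (Complex.exp ((2 * (m * t) : ℝ) * Complex.I) * g t ^ 2) = w ^ 2 / 2 := by
        rw [hw, mul_pow, ← Complex.exp_nat_mul, div_mul_eq_mul_div, ← mul_assoc, ← Complex.exp_add]
        congr 4
        push_cast
        ring
      have e2 : ‖g t‖ = ‖w‖ := by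
        rw [hw, norm_mul, Complex.norm_exp_ofReal_mul_I, one_mul]
      have e3 : modulated m γ g t = w.re := rfl
      rw [e1, e2, e3, Complex.sq_norm, Complex.normSq_apply]
      have : (w ^ 2 / 2).re = (w.re * w.re - w.im * w.im) / 2 := by
        rw [sq, show w * w / 2 = ((1 / 2 : ℝ) : ℂ) * (w * w) by push_cast; ring,
          Complex.re_ofReal_mul, Complex.mul_re]
        ring
      rw [this]; ring
    simp_rw [h2]
    have hci : Integrable (fun t => Complex.exp ((2 * γ : ℝ) * Complex.I) / 2 *
          (Complex.exp ((2 * (m * t) : ℝ) * Complex.I) * g t ^ 2)) periodMeasure :=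
      (Continuous.integrableOn_Icc (a := 0) (b := 2 * Real.pi)
        (by fun_prop)).mono_set Ioc_subset_Icc_self
    have e4 := integral_re hci
    have hre := hci.re
    simp only [RCLike.re_eq_complex_re] at e4 hre
    rw [integral_add (integrable_periodMeasure (by fun_prop)) hre, e4, integral_const_mul, h0]
    simp
  obtain ⟨⟨τ₁, h1, h1'⟩, τ₂, h2, h2'⟩ := exists_lsNorm_modulated_le_ge hp hc m γ one_le_two
  rw [key] at h1' h2' ⊢
  exact le_antisymm h1' h2'

/-! ### The generating function on the circle of radius `q`: identities and smoothness. -/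

/-- The generating function `∑ min (j + 1, p) z ^ j = (1 - z ^ p) / (1 - z) ^ 2`. -/
noncomputable def vpGen (p : ℕ) (z : ℂ) : ℂ := (1 - z ^ p) / (1 - z) ^ 2

/-- The values of `vpGen p` on the circle of radius `q`. -/
noncomputable def vpCurve (q : ℝ) (p : ℕ) (t : ℝ) : ℂ := vpGen p (q * Complex.exp (t * Complex.I))

/-- Write `min (j + 1) p` as `j + 1` minus the positive part of `j + 1 - p`; the second series is `z
^ p` times the first. -/
theorem hasSum_vpGen {z : ℂ} (hz : ‖z‖ < 1) (p : ℕ) :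
    HasSum (fun j : ℕ => ((min (j + 1) p : ℕ) : ℂ) * z ^ j) (vpGen p z) := by
  have hA : HasSum (fun j : ℕ => ((j : ℂ) + 1) * z ^ j) (1 / (1 - z) ^ 2) := by
    have := hasSum_choose_mul_geometric_of_norm_lt_one 1 hz
    convert! this using 1
    funext j
    simp
  have hB : HasSum (fun j : ℕ => if p ≤ j then ((j - p : ℕ) + 1 : ℂ) * z ^ j else 0)
      (z ^ p * (1 / (1 - z) ^ 2)) := by
    rw [← (add_left_injective p).hasSum_iff]
    · convert! hA.mul_left (z ^ p) using 1
      funext j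
      simp only [Function.comp_apply, Nat.le_add_left, if_true, Nat.add_sub_cancel, pow_add]
      ring
    · intro j hj
      rw [if_neg]
      intro h
      exact hj ⟨j - p, by simp only; omega⟩
  convert! hA.sub hB using 1
  · funext j
    split_ifs with h
    · rw [min_eq_right (by omega), ← sub_mul]
      congr 1
      push_cast [h]
      ring
    · rw [min_eq_left (by omega)]
      push_cast
      ring
  · rw [vpGen]; ring

theorem norm_mul_exp_mul_I {q : ℝ} (h0 : 0 ≤ q) (t : ℝ) :
    ‖(q : ℂ) * Complex.exp (t * Complex.I)‖ = q := by
  rw [norm_mul, Complex.norm_exp_ofReal_mul_I, mul_one, Complex.norm_real, Real.norm_of_nonneg h0]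

theorem one_sub_le_norm_one_sub {q : ℝ} (h0 : 0 ≤ q) (t : ℝ) :
    1 - q ≤ ‖1 - (q : ℂ) * Complex.exp (t * Complex.I)‖ := by
  have := norm_sub_norm_le (1 : ℂ) (q * Complex.exp (t * Complex.I))
  rwa [norm_one, norm_mul_exp_mul_I h0] at this

theorem one_sub_ne_zero {q : ℝ} (h0 : 0 ≤ q) (h1 : q < 1) (t : ℝ) :
    1 - (q : ℂ) * Complex.exp (t * Complex.I) ≠ 0 := by
  have := one_sub_le_norm_one_sub h0 t
  exact norm_pos_iff.mp (by linarith)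

theorem norm_one_sub_sq (q t : ℝ) :
    ‖1 - (q : ℂ) * Complex.exp (t * Complex.I)‖ ^ 2 = 1 - 2 * q * Real.cos t + q ^ 2 := by
  rw [Complex.sq_norm, Complex.normSq_apply]
  have h1 : (1 - (q : ℂ) * Complex.exp (t * Complex.I)).re = 1 - q * Real.cos t := by
    rw [Complex.sub_re, Complex.re_ofReal_mul, Complex.exp_ofReal_mul_I_re, Complex.one_re]
  have h2 : (1 - (q : ℂ) * Complex.exp (t * Complex.I)).im = - (q * Real.sin t) := by
    rw [Complex.sub_im, Complex.im_ofReal_mul, Complex.exp_ofReal_mul_I_im, Complex.one_im, zero_sub]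
  rw [h1, h2]
  linear_combination q ^ 2 * Real.sin_sq_add_cos_sq t

theorem mul_exp_pow (q t : ℝ) (p : ℕ) : ((q : ℂ) * Complex.exp (t * Complex.I)) ^ p =
    ((q ^ p : ℝ) : ℂ) * Complex.exp ((p * t : ℝ) * Complex.I) := by
  rw [mul_pow, ← Complex.exp_nat_mul]
  push_cast
  ring_nf

theorem norm_vpCurve (q : ℝ) (p : ℕ) (t : ℝ) : ‖vpCurve q p t‖ =
    Real.sqrt (1 - 2 * q ^ p * Real.cos (p * t) + q ^ (2 * p)) / (1 - 2 * q * Real.cos t + q ^ 2) := by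
  rw [vpCurve, vpGen, norm_div, norm_pow, norm_one_sub_sq, mul_exp_pow, mul_comm 2 p, pow_mul,
    ← norm_one_sub_sq (q ^ p), Real.sqrt_sq (norm_nonneg _)]

theorem vpCurve_periodic (q : ℝ) (p : ℕ) : Function.Periodic (vpCurve q p) (2 * Real.pi) := by
  intro t
  have : Complex.exp (((t + 2 * Real.pi : ℝ) : ℂ) * Complex.I) = Complex.exp (t * Complex.I) := by
    push_cast
    rw [add_mul, Complex.exp_add, Complex.exp_two_pi_mul_I, mul_one]
  rw [vpCurve, vpCurve, this]

theorem vpCurve_continuous {q : ℝ} (h0 : 0 ≤ q) (h1 : q < 1) (p : ℕ) :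
    Continuous (vpCurve q p) := by
  unfold vpCurve vpGen
  exact Continuous.div (by fun_prop) (by fun_prop) fun t => pow_ne_zero 2 (one_sub_ne_zero h0 h1 t)

theorem vpCurve_hasSum {q : ℝ} (h0 : 0 ≤ q) (h1 : q < 1) (p : ℕ) (t : ℝ) :
    HasSum (fun j : ℕ => (((min (j + 1) p : ℕ) * q ^ j : ℝ) : ℂ) *
      Complex.exp ((j * t : ℝ) * Complex.I)) (vpCurve q p t) := by
  convert! hasSum_vpGen (z := q * Complex.exp (t * Complex.I))
    (by rwa [norm_mul_exp_mul_I h0]) p using 1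
  funext j
  rw [mul_exp_pow, Complex.ofReal_mul, Complex.ofReal_natCast, mul_assoc]

theorem modulated_vpCurve {q : ℝ} (h0 : 0 ≤ q) (h1 : q < 1) (p m : ℕ) (γ : ℝ) :
    modulated m γ (vpCurve q p) = tailKernel m (fun j => (min (j + 1) p : ℕ) * q ^ j) γ := by
  funext t
  have h := Complex.hasSum_re
    ((vpCurve_hasSum h0 h1 p t).mul_left (Complex.exp ((m * t + γ : ℝ) * Complex.I)))
  rw [modulated, ← h.tsum_eq, tailKernel]
  refine tsum_congr fun j => ?_
  rw [mul_left_comm, ← Complex.exp_add, ← add_mul, ← Complex.ofReal_add, Complex.re_ofReal_mul,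
    Complex.exp_ofReal_mul_I_re]
  push_cast
  ring_nf

theorem norm_exp_mul_I_sub_le (x y : ℝ) :
    ‖Complex.exp (x * Complex.I) - Complex.exp (y * Complex.I)‖ ≤ |x - y| := by
  have h1 : Complex.exp (x * Complex.I) - Complex.exp (y * Complex.I) =
      Complex.exp (y * Complex.I) * (Complex.exp (Complex.I * (x - y : ℝ)) - 1) := by
    rw [mul_sub, ← Complex.exp_add]
    push_cast
    ring_nf
  rw [h1, norm_mul, Complex.norm_exp_ofReal_mul_I, one_mul]
  exact Real.norm_exp_I_mul_ofReal_sub_one_le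

/-- Termwise Lipschitz estimate with the weights bounded by `j + 1`: `∑ j (j + 1) q ^ j = 2 q / (1 -
q) ^ 3`, uniformly in `p`. This is `σ = 3`. -/
theorem norm_vpCurve_add_sub_le {q : ℝ} (h0 : 0 < q) (h1 : q < 1) (p : ℕ) {τ : ℝ} (hτ : 0 ≤ τ)
    (t : ℝ) : ‖vpCurve q p (t + τ) - vpCurve q p t‖ ≤ 2 * q / (1 - q) ^ 3 * τ := by
  have h := (vpCurve_hasSum h0.le h1 p (t + τ)).sub (vpCurve_hasSum h0.le h1 p t)
  have hB : HasSum (fun j : ℕ => ((j : ℝ) + 1) * q ^ j * j * τ) (2 * q / (1 - q) ^ 3 * τ) := by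
    refine HasSum.mul_right τ ?_
    rw [← hasSum_nat_add_iff' 1]
    convert! (hasSum_succ_mul_succ_mul_geometric h0.le h1).mul_left q using 1
    · funext j
      push_cast
      ring
    · simp; ring
  rw [← h.tsum_eq]
  refine tsum_of_norm_bounded hB fun j => ?_
  rw [← mul_sub, norm_mul, Complex.norm_real, Real.norm_of_nonneg (by positivity), mul_assoc _ (j : ℝ)]
  refine mul_le_mul (mul_le_mul_of_nonneg_right ?_ (by positivity)) ?_ (norm_nonneg _)
    (by positivity)
  · exact_mod_cast min_le_left _ _
  · refine (norm_exp_mul_I_sub_le _ _).trans (le_of_eq ?_)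
    rw [show (j : ℝ) * (t + τ) - j * t = j * τ by ring, abs_of_nonneg (by positivity)]

/-- For `p = 1` the curve is `1 / (1 - z)`, and the difference of two reciprocals is explicit.
Keeping both denominators gives `σ = 2` in the supremum norm and `σ = 1` in `L_1`. -/
theorem norm_vpCurve_one_add_sub_le {q : ℝ} (h0 : 0 < q) (h1 : q < 1) {τ : ℝ} (hτ : 0 ≤ τ)
    (t : ℝ) : ‖vpCurve q 1 (t + τ) - vpCurve q 1 t‖ ≤
      q * τ / (‖1 - (q : ℂ) * Complex.exp ((t + τ : ℝ) * Complex.I)‖ *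
        ‖1 - (q : ℂ) * Complex.exp (t * Complex.I)‖) := by
  have e1 := one_sub_ne_zero h0.le h1 t
  have e2 := one_sub_ne_zero h0.le h1 (t + τ)
  have : vpCurve q 1 (t + τ) - vpCurve q 1 t =
      q * (Complex.exp ((t + τ : ℝ) * Complex.I) - Complex.exp (t * Complex.I)) /
        ((1 - (q : ℂ) * Complex.exp ((t + τ : ℝ) * Complex.I)) *
          (1 - (q : ℂ) * Complex.exp (t * Complex.I))) := by
    rw [vpCurve, vpCurve, vpGen, vpGen]
    generalize Complex.exp ((t + τ : ℝ) * Complex.I) = x at e2 ⊢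
    generalize Complex.exp (t * Complex.I) = y at e1 ⊢
    field_simp
    ring
  rw [this, norm_div, norm_mul, norm_mul, Complex.norm_real, Real.norm_of_nonneg h0.le]
  refine div_le_div_of_nonneg_right (mul_le_mul_of_nonneg_left ?_ h0.le) (by positivity)
  refine (norm_exp_mul_I_sub_le _ _).trans (le_of_eq ?_)
  rw [add_sub_cancel_left, abs_of_nonneg hτ]

theorem integral_comp_circle {F : ℂ → ℂ} {q : ℝ} (h0 : 0 ≤ q)
    (hF : ∀ z ∈ Metric.closedBall (0 : ℂ) q, DifferentiableAt ℂ F z) :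
    ∫ t : ℝ, F (q * Complex.exp (t * Complex.I)) ∂periodMeasure = 2 * Real.pi * F 0 := by
  have h := DiffContOnCl.circleAverage (c := 0) (R := q) (f := F) (by
    rw [abs_of_nonneg h0]
    refine DifferentiableOn.diffContOnCl fun z hz => (hF z ?_).differentiableWithinAt
    exact Metric.closure_ball_subset_closedBall hz)
  rw [Real.circleAverage_def, intervalIntegral.integral_of_le Real.two_pi_pos.le] at h
  have h2 : ∀ t : ℝ, circleMap 0 q t = q * Complex.exp (t * Complex.I) := fun t => by
    simp [circleMap]
  simp only [h2] at h
  have : (2 * Real.pi : ℂ) ≠ 0 := by exact_mod_cast Real.two_pi_pos.ne'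
  rw [periodMeasure, ← h, Complex.real_smul, Complex.ofReal_inv, Complex.ofReal_mul,
    Complex.ofReal_ofNat, mul_inv_cancel_left₀ this]

theorem one_sub_ne_zero_of_mem_closedBall {q : ℝ} (h1 : q < 1) {z : ℂ}
    (hz : z ∈ Metric.closedBall (0 : ℂ) q) : 1 - z ≠ 0 := by
  intro h
  rw [sub_eq_zero] at h
  rw [← h, mem_closedBall_zero_iff, norm_one] at hz
  linarith

/-- Mean value property for `z ^ (2m) * vpGen p z ^ 2`, analytic on the closed disc of radius `q`
and zero at the origin since `m ≥ 1`. -/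
theorem integral_exp_mul_vpCurve_sq {q : ℝ} (h0 : 0 < q) (h1 : q < 1) (p : ℕ) {m : ℕ} (hm : 1 ≤ m) :
    ∫ t : ℝ, Complex.exp ((2 * (m * t) : ℝ) * Complex.I) * vpCurve q p t ^ 2 ∂periodMeasure = 0 := by
  have h := integral_comp_circle (F := fun z => z ^ (2 * m) * vpGen p z ^ 2) h0.le (fun z hz => by
    have := pow_ne_zero 2 (one_sub_ne_zero_of_mem_closedBall h1 hz)
    unfold vpGen
    fun_prop (disch := assumption))
  simp only [mul_exp_pow] at h
  rw [zero_pow (by omega), zero_mul, mul_zero] at h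
  have h2 : ∀ t : ℝ, ((q ^ (2 * m) : ℝ) : ℂ) * Complex.exp (((2 * m : ℕ) * t : ℝ) * Complex.I) *
      vpGen p (q * Complex.exp (t * Complex.I)) ^ 2 =
      ((q ^ (2 * m) : ℝ) : ℂ) * (Complex.exp ((2 * (m * t) : ℝ) * Complex.I) * vpCurve q p t ^ 2) := by
    intro t
    rw [vpCurve, mul_assoc]
    push_cast
    ring_nf
  simp_rw [h2] at h
  rw [integral_const_mul, mul_eq_zero] at h
  refine h.resolve_left ?_
  exact_mod_cast (pow_pos h0 _).ne'

/-- The Poisson kernel `(1 - q²) / |1 - z|²` is the real part of `(1 + z) / (1 - z)`, whose mean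
over the circle is its value `1` at the centre. -/
theorem integral_inv_norm_one_sub_sq {q : ℝ} (h0 : 0 < q) (h1 : q < 1) :
    ∫ t : ℝ, 1 / ‖1 - (q : ℂ) * Complex.exp (t * Complex.I)‖ ^ 2 ∂periodMeasure =
      2 * Real.pi / (1 - q ^ 2) := by
  have h := integral_comp_circle (F := fun z => (1 + z) / (1 - z)) h0.le (fun z hz => by
    have := one_sub_ne_zero_of_mem_closedBall h1 hz
    fun_prop (disch := assumption))
  have hq : 0 < 1 - q ^ 2 := by nlinarith
  have hci : Integrable (fun t : ℝ => (1 + (q : ℂ) * Complex.exp (t * Complex.I)) /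
      (1 - (q : ℂ) * Complex.exp (t * Complex.I))) periodMeasure :=
    (Continuous.integrableOn_Icc (a := 0) (b := 2 * Real.pi)
      (Continuous.div (by fun_prop) (by fun_prop) (one_sub_ne_zero h0.le h1))).mono_set
      Ioc_subset_Icc_self
  have h2 := integral_re hci
  rw [h] at h2
  simp only [RCLike.re_eq_complex_re] at h2
  have h3 : ∀ t : ℝ, ((1 + (q : ℂ) * Complex.exp (t * Complex.I)) /
      (1 - (q : ℂ) * Complex.exp (t * Complex.I))).re =
      (1 - q ^ 2) * (1 / ‖1 - (q : ℂ) * Complex.exp (t * Complex.I)‖ ^ 2) := by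
    intro t
    set z := (q : ℂ) * Complex.exp (t * Complex.I) with hz
    have hzn : z.re ^ 2 + z.im ^ 2 = q ^ 2 := by
      rw [← norm_mul_exp_mul_I h0.le t, ← hz, Complex.sq_norm, Complex.normSq_apply]; ring
    rw [Complex.div_re, Complex.sq_norm]
    simp only [Complex.add_re, Complex.sub_re, Complex.one_re, Complex.add_im, Complex.sub_im,
      Complex.one_im]
    rw [← hzn]
    ring
  simp_rw [h3] at h2
  rw [integral_const_mul] at h2
  rw [eq_div_iff hq.ne', mul_comm, h2]
  simp

/-- The product of the two reciprocals is at most half the sum of their squares, and each square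
integrates to `2π / (1 - q²)`: one power of `1 - q` is gained over the supremum bound. -/
theorem toReal_eLpNorm_one_vpCurve_one_le {q : ℝ} (h0 : 0 < q) (h1 : q < 1) {τ : ℝ} (hτ : 0 ≤ τ) :
    (eLpNorm (fun t => vpCurve q 1 (t + τ) - vpCurve q 1 t) 1 periodMeasure).toReal ≤
      2 * Real.pi * (q / (1 - q) * τ) := by
  set k : ℝ → ℝ := fun t => 1 / ‖1 - (q : ℂ) * Complex.exp (t * Complex.I)‖ ^ 2 with hk
  have hkc : Continuous k := by
    refine Continuous.div (by fun_prop) (by fun_prop) fun t => ?_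
    exact pow_ne_zero 2 (norm_ne_zero_iff.mpr (one_sub_ne_zero h0.le h1 t))
  have hkp : Function.Periodic k (2 * Real.pi) := by
    intro t
    have : Complex.exp (((t + 2 * Real.pi : ℝ) : ℂ) * Complex.I) = Complex.exp (t * Complex.I) := by
      push_cast
      rw [add_mul, Complex.exp_add, Complex.exp_two_pi_mul_I, mul_one]
    simp only [hk]
    rw [this]
  have hki := integral_inv_norm_one_sub_sq h0 h1
  have hk0 : ∀ t, 0 ≤ k t := fun t => by positivity
  have hshift : ∫ t, k (t + τ) ∂periodMeasure = ∫ t, k t ∂periodMeasure := by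
    have h := congrArg ENNReal.toReal (eLpNorm_add_right hkp hkc 1 τ)
    rw [eLpNorm_one_eq_lintegral_enorm, eLpNorm_one_eq_lintegral_enorm,
      ← integral_norm_eq_lintegral_enorm (by fun_prop),
      ← integral_norm_eq_lintegral_enorm (by fun_prop)] at h
    simpa only [Real.norm_of_nonneg (hk0 _)] using h
  have hg := vpCurve_continuous h0.le h1 1
  rw [eLpNorm_one_eq_lintegral_enorm, ← integral_norm_eq_lintegral_enorm (by fun_prop)]
  have hle : ∀ t, ‖vpCurve q 1 (t + τ) - vpCurve q 1 t‖ ≤ q * τ / 2 * (k (t + τ) + k t) := by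
    intro t
    refine (norm_vpCurve_one_add_sub_le h0 h1 hτ t).trans ?_
    simp only [hk]
    set x := ‖1 - (q : ℂ) * Complex.exp ((t + τ : ℝ) * Complex.I)‖ with hx
    set y := ‖1 - (q : ℂ) * Complex.exp (t * Complex.I)‖ with hy
    have : 0 ≤ q * τ := by positivity
    calc q * τ / (x * y) = q * τ / 2 * (2 * (1 / x) * (1 / y)) := by
          rw [one_div, one_div, div_eq_mul_inv (q * τ) (x * y), mul_inv]; ring
      _ ≤ q * τ / 2 * ((1 / x) ^ 2 + (1 / y) ^ 2) :=
        mul_le_mul_of_nonneg_left (two_mul_le_add_sq _ _) (by positivity)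
      _ = _ := by rw [one_div_pow, one_div_pow]
  have h2 : ∫ t, ‖vpCurve q 1 (t + τ) - vpCurve q 1 t‖ ∂periodMeasure ≤
      ∫ t, q * τ / 2 * (k (t + τ) + k t) ∂periodMeasure :=
    integral_mono (integrable_periodMeasure (by fun_prop)) (integrable_periodMeasure (by fun_prop)) hle
  refine h2.trans ?_
  rw [integral_const_mul, integral_add (integrable_periodMeasure (by fun_prop))
    (integrable_periodMeasure (by fun_prop)), hshift, hki]
  have hq : 0 < 1 - q := by linarith
  have e : q * τ / 2 * (2 * Real.pi / (1 - q ^ 2) + 2 * Real.pi / (1 - q ^ 2)) =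
      2 * Real.pi * (q * τ / (1 - q ^ 2)) := by ring
  rw [e]
  refine mul_le_mul_of_nonneg_left ?_ (by positivity)
  rw [div_mul_eq_mul_div]
  exact div_le_div_of_nonneg_left (by positivity) hq (by nlinarith)

theorem eLpNorm_vpCurve_add_sub_le {q : ℝ} (h0 : 0 < q) (h1 : q < 1) {p : ℕ} (hp : 1 ≤ p)
    {u : ℝ≥0∞} (hu : 1 ≤ u) {τ : ℝ} (hτ : 0 ≤ τ) :
    (eLpNorm (fun t => vpCurve q p (t + τ) - vpCurve q p t) u periodMeasure).toReal ≤
      2 * Real.pi * (2 * q / (1 - q) ^ sigmaExp u p * τ) := by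
  have hq : 0 < 1 - q := by linarith
  rw [sigmaExp]
  split_ifs with hp1 hu1
  · subst hp1 hu1
    refine (toReal_eLpNorm_one_vpCurve_one_le h0 h1 hτ).trans ?_
    refine mul_le_mul_of_nonneg_left (mul_le_mul_of_nonneg_right ?_ hτ) (by positivity)
    rw [pow_one]
    exact div_le_div_of_nonneg_right (by linarith) hq.le
  · subst hp1
    refine toReal_eLpNorm_le_of_bound hu (by positivity) fun t => ?_
    refine (norm_vpCurve_one_add_sub_le h0 h1 hτ t).trans ?_
    have e1 := one_sub_le_norm_one_sub h0.le t
    have e2 := one_sub_le_norm_one_sub h0.le (t + τ)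
    calc _ ≤ q * τ / ((1 - q) * (1 - q)) :=
          div_le_div_of_nonneg_left (by positivity) (by positivity)
            (mul_le_mul e2 e1 hq.le (norm_nonneg _))
      _ = q / (1 - q) ^ 2 * τ := by ring
      _ ≤ _ := by
        refine mul_le_mul_of_nonneg_right ?_ hτ
        exact div_le_div_of_nonneg_right (by linarith) (by positivity)
  · exact toReal_eLpNorm_le_of_bound hu (by positivity) fun t => norm_vpCurve_add_sub_le h0 h1 p hτ t

/-! ### The norm of the convolution kernel. -/

theorem pi_mul_mainTerm (q : ℝ) (p : ℕ) (u : ℝ≥0∞) :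
    Real.pi * mainTerm q p u = phaseMean u (vpCurve q p) := by
  have : lsNorm u (fun t => Real.sqrt (1 - 2 * q ^ p * Real.cos (p * t) + q ^ (2 * p)) /
      (1 - 2 * q * Real.cos t + q ^ 2)) = (eLpNorm (vpCurve q p) u periodMeasure).toReal := by
    simp_rw [← norm_vpCurve]
    rw [lsNorm, eLpNorm_norm]
  rw [mainTerm, constK, this, phaseMean, Real.rpow_add Real.pi_pos, Real.rpow_one,
    Real.rpow_neg zero_le_two, Real.mul_rpow zero_le_two Real.pi_pos.le]
  have h1 := (Real.rpow_pos_of_pos Real.pi_pos (u⁻¹).toReal).ne'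
  have h2 := (Real.rpow_pos_of_pos zero_lt_two (u⁻¹).toReal).ne'
  have h3 := Real.pi_ne_zero
  field_simp

theorem abs_lsNorm_tailKernel_geometric_sub_le {q : ℝ} (h0 : 0 < q) (h1 : q < 1) {p m : ℕ}
    (hp : 1 ≤ p) (hm : 1 ≤ m) {s u : ℝ≥0∞} (hu : 1 ≤ u) (hsu : s⁻¹ + u⁻¹ = 1) (γ : ℝ) :
    |lsNorm u (tailKernel m (fun j => (min (j + 1) p : ℕ) * q ^ j) γ) - Real.pi * mainTerm q p u| ≤
      80 * (q * deltaFn s / (m * (1 - q) ^ sigmaExp u p)) := by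
  have hq : 0 < 1 - q := by linarith
  have hm0 : (0 : ℝ) < m := by exact_mod_cast hm
  rw [pi_mul_mainTerm, ← modulated_vpCurve h0.le h1, deltaFn]
  split_ifs with hs
  · have hu2 : u = 2 := by
      rw [hs] at hsu
      rw [← inv_inj]
      exact (ENNReal.add_right_inj (by simp : (2 : ℝ≥0∞)⁻¹ ≠ ∞)).mp
        (hsu.trans ENNReal.inv_two_add_inv_two.symm)
    rw [hu2, lsNorm_two_modulated_eq (vpCurve_periodic q p) (vpCurve_continuous h0.le h1 p) m γ
      (integral_exp_mul_vpCurve_sq h0 h1 p hm)]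
    simp
  · refine (abs_lsNorm_modulated_sub_le (vpCurve_periodic q p) (vpCurve_continuous h0.le h1 p) hm γ hu
      (D := 2 * Real.pi * (2 * q / (1 - q) ^ sigmaExp u p * (2 * Real.pi / m))) ?_).trans ?_
    · intro τ hτ
      refine (eLpNorm_vpCurve_add_sub_le h0 h1 hp hu hτ.1).trans ?_
      refine mul_le_mul_of_nonneg_left (mul_le_mul_of_nonneg_left hτ.2 ?_) (by positivity)
      positivity
    · have : 2 * Real.pi * (2 * q / (1 - q) ^ sigmaExp u p * (2 * Real.pi / m)) =
          8 * Real.pi ^ 2 * (q * 1 / (m * (1 - q) ^ sigmaExp u p)) := by field_simp; ring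
      rw [this]
      refine mul_le_mul_of_nonneg_right ?_ (by positivity)
      -- The constant `80` is a bound for `8π² = 2π * 2 * 2π`, the last `2π` being the range of
      -- phases.
      nlinarith [Real.pi_lt_d2, Real.pi_pos]

theorem abs_lsNorm_const_mul (s : ℝ≥0∞) (c : ℝ) (f : ℝ → ℝ) :
    lsNorm s (fun t => c * f t) = |c| * lsNorm s f := by
  have := eLpNorm_const_smul c f s periodMeasure
  have e : (fun t => c * f t) = c • f := rfl
  rw [lsNorm, lsNorm, e, this, ENNReal.toReal_mul, toReal_enorm, Real.norm_eq_abs]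

theorem tailKernel_mul_add {m : ℕ} {v w : ℕ → ℝ} (hv : Summable fun j => |v j|)
    (hw : Summable fun j => |w j|) (c γ t : ℝ) :
    tailKernel m (fun j => c * (v j + w j)) γ t = c * (tailKernel m v γ t + tailKernel m w γ t) := by
  have h1 : Summable fun j => v j * Real.cos ((m + j : ℕ) * t + γ) :=
    Summable.of_norm_bounded hv fun _ => abs_mul_cos_le _ _
  have h2 : Summable fun j => w j * Real.cos ((m + j : ℕ) * t + γ) :=
    Summable.of_norm_bounded hw fun _ => abs_mul_cos_le _ _
  rw [tailKernel, tailKernel, tailKernel, ← h1.tsum_add h2, ← tsum_mul_left]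
  exact tsum_congr fun j => by ring

theorem abs_tailKernel_le (m : ℕ) {v : ℕ → ℝ} (hv : Summable v) (hv0 : ∀ j, 0 ≤ v j) (γ t : ℝ) :
    |tailKernel m v γ t| ≤ ∑' j, v j :=
  tsum_of_norm_bounded (f := fun j => v j * Real.cos ((m + j : ℕ) * t + γ)) hv.hasSum fun j =>
    (abs_mul_cos_le _ _).trans (le_of_eq (abs_of_nonneg (hv0 j)))

theorem summable_min_mul_pow {q : ℝ} (h0 : 0 < q) (h1 : q < 1) (p : ℕ) :
    Summable fun j : ℕ => ((min (j + 1) p : ℕ) : ℝ) * q ^ j := by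
  refine Summable.of_nonneg_of_le (fun j => by positivity) (fun j => ?_)
    ((summable_geometric_of_lt_one h0.le h1).mul_left (p : ℝ))
  exact mul_le_mul_of_nonneg_right (by exact_mod_cast min_le_right _ _) (by positivity)

theorem polyPsi_pos {q : ℝ} (h0 : 0 < q) (h1 : q < 1) (l k : ℕ) : 0 < polyPsi q l k := by
  rw [polyPsi_eq]
  have := one_le_polyFactor (l := l) (m := k) h0 h1
  exact mul_pos (pow_pos h0 k) (by linarith)

theorem polyPsi_add {q : ℝ} (h0 : 0 < q) (h1 : q < 1) (l m j : ℕ) :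
    polyPsi q l (m + j) = polyPsi q l m *
      (q ^ j + q ^ j * (polyFactor q l (m + j) / polyFactor q l m - 1)) := by
  have := one_le_polyFactor (l := l) (m := m) h0 h1
  rw [polyPsi_eq, polyPsi_eq, pow_add]
  have : polyFactor q l m ≠ 0 := by linarith
  field_simp
  ring

theorem summable_polyPsi {q : ℝ} (h0 : 0 < q) (h1 : q < 1) (l : ℕ) : Summable (polyPsi q l) := by
  obtain ⟨hs, -⟩ := polyPsi_ratio_bound (l := l) (m := 1) (K := polyConst l)
    (by unfold polyConst; positivity) h0 h1 le_rfl (fun j => sum_polyTerm_mul_le h0 h1 le_rfl) 1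
  rw [← summable_nat_add_iff 1]
  simp_rw [add_comm _ 1, polyPsi_add h0 h1]
  refine ((summable_geometric_of_lt_one h0.le h1).add ?_).mul_left _
  convert! hs using 2 with j
  rw [min_eq_right (by omega), Nat.cast_one, one_mul]

theorem remainder_parts_nonneg {q : ℝ} (h0 : 0 < q) (h1 : q < 1) (l m p : ℕ) (s u : ℝ≥0∞) :
    0 ≤ q * deltaFn s / ((m : ℝ) * (1 - q) ^ sigmaExp u p) ∧
      0 ≤ (l : ℝ) * q / ((m : ℝ) * (1 - q) ^ 2) * min (p : ℝ) (1 / (1 - q)) := by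
  have hq : 0 < 1 - q := by linarith
  have : 0 ≤ deltaFn s := by unfold deltaFn; split_ifs <;> norm_num
  exact ⟨by positivity, by positivity⟩

/-- Strictness comes from the second summand, as `δ(2) = 0` may kill the first. It is needed both to
absorb the loss of near-extremality and to divide when solving for `θ`. -/
theorem remainder_pos {q : ℝ} (h0 : 0 < q) (h1 : q < 1) {l m p : ℕ} (hl : 1 ≤ l) (hm : 1 ≤ m)
    (hp : 1 ≤ p) (s u : ℝ≥0∞) : 0 < remainder q l m p s u := by
  have hq : 0 < 1 - q := by linarith
  have h2 := (remainder_parts_nonneg h0 h1 l m p s u).1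
  have hl' : (0 : ℝ) < l := by exact_mod_cast hl
  have hm' : (0 : ℝ) < m := by exact_mod_cast hm
  have hp' : (0 : ℝ) < p := by exact_mod_cast hp
  have h3 : 0 < min (p : ℝ) (1 / (1 - q)) := lt_min hp' (by positivity)
  have : 0 < (l : ℝ) * q / ((m : ℝ) * (1 - q) ^ 2) * min (p : ℝ) (1 / (1 - q)) := by positivity
  rw [remainder]
  linarith

/-- The weights of the convolution kernel of the deviation. -/
noncomputable def kernelWeight (q : ℝ) (l m p j : ℕ) : ℝ := (min (j + 1) p : ℕ) * polyPsi q l (m + j)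

theorem summable_abs_kernelWeight {q : ℝ} (h0 : 0 < q) (h1 : q < 1) (l m p : ℕ) :
    Summable fun j => |kernelWeight q l m p j| := by
  have : Summable fun j => polyPsi q l (m + j) :=
    (summable_polyPsi h0 h1 l).comp_injective (add_right_injective m)
  refine Summable.of_nonneg_of_le (fun _ => abs_nonneg _) (fun j => ?_) (this.mul_left (p : ℝ))
  rw [kernelWeight, abs_of_nonneg (mul_nonneg (Nat.cast_nonneg _) (polyPsi_pos h0 h1 _ _).le)]
  exact mul_le_mul_of_nonneg_right (by exact_mod_cast min_le_right _ _) (polyPsi_pos h0 h1 _ _).le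

/-- The geometric part contributes `80 ≤ 26 π`; the oscillating part is bounded in supremum norm by
the sum of its weights, contributing `2π * 32 K`. -/
theorem abs_lsNorm_kernel_sub_le {q : ℝ} (h0 : 0 < q) (h1 : q < 1) {l p m : ℕ}
    (hp : 1 ≤ p) (hm : 1 ≤ m) {s u : ℝ≥0∞} (hu : 1 ≤ u) (hsu : s⁻¹ + u⁻¹ = 1) (γ : ℝ) {K : ℝ}
    (hK : 0 ≤ K)
    (hsum : ∀ j : ℕ, ∑ i ∈ Finset.Icc 1 (l - 1), polyTerm q i m * (1 + (j : ℝ) / m) ^ i ≤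
      K * (polyFactor q l m * Real.exp ((1 - q) / 2 * j))) :
    |lsNorm u (tailKernel m (kernelWeight q l m p) γ) - polyPsi q l m * (Real.pi * mainTerm q p u)| ≤
      polyPsi q l m * (Real.pi * ((26 + 64 * K) * remainder q l m p s u)) := by
  obtain ⟨hs, ht⟩ := polyPsi_ratio_bound hK h0 h1 hm hsum p
  have hψ := polyPsi_pos h0 h1 l m
  set v : ℕ → ℝ := fun j => (min (j + 1) p : ℕ) * q ^ j with hv
  set w : ℕ → ℝ := fun j => ((min (j + 1) p : ℕ) : ℝ) *
    (q ^ j * (polyFactor q l (m + j) / polyFactor q l m - 1)) with hw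
  have hv0 : ∀ j, 0 ≤ v j := fun j => by positivity
  have hw0 : ∀ j, 0 ≤ w j := fun j => mul_nonneg (Nat.cast_nonneg _)
    (mul_nonneg (by positivity) (polyFactor_add_sub_nonneg h0 h1))
  have hvs : Summable fun j => |v j| := by
    simpa only [abs_of_nonneg (hv0 _)] using summable_min_mul_pow h0 h1 p
  have hws : Summable fun j => |w j| := by simpa only [abs_of_nonneg (hw0 _)] using hs
  have hkw : kernelWeight q l m p = fun j => polyPsi q l m * (v j + w j) := by
    funext j
    rw [kernelWeight, polyPsi_add h0 h1, hv, hw]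
    ring
  have hk : tailKernel m (kernelWeight q l m p) γ =
      fun t => polyPsi q l m * (tailKernel m v γ t + tailKernel m w γ t) := by
    funext t
    rw [hkw]
    exact tailKernel_mul_add hvs hws _ _ _
  have hvC := tailKernel_memC m hvs γ
  have hwC := tailKernel_memC m hws γ
  have e1 : |lsNorm u (fun t => tailKernel m v γ t + tailKernel m w γ t) -
      lsNorm u (tailKernel m v γ)| ≤ 2 * Real.pi * ∑' j, w j := by
    refine (abs_lsNorm_sub_le hu (memLp_of_continuous_periodic (hvC.1.add hwC.1)
      (hvC.2.add hwC.2) u) (memLp_of_continuous_periodic hvC.1 hvC.2 u)).trans ?_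
    refine toReal_eLpNorm_le_of_bound hu (tsum_nonneg hw0) fun t => ?_
    rw [Pi.add_apply, add_sub_cancel_left]
    exact abs_tailKernel_le m hs hw0 γ t
  have e2 := abs_lsNorm_tailKernel_geometric_sub_le h0 h1 hp hm hu hsu γ
  rw [hk, abs_lsNorm_const_mul, abs_of_pos hψ, ← mul_sub, abs_mul, abs_of_pos hψ]
  refine mul_le_mul_of_nonneg_left ?_ hψ.le
  obtain ⟨r1, r2⟩ := remainder_parts_nonneg h0 h1 l m p s u
  rw [remainder]
  set X := q * deltaFn s / ((m : ℝ) * (1 - q) ^ sigmaExp u p)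
  set Y := (l : ℝ) * q / ((m : ℝ) * (1 - q) ^ 2) * min (p : ℝ) (1 / (1 - q))
  have e3 : 2 * Real.pi * ∑' j, w j ≤ Real.pi * (64 * K * Y) := by
    have := mul_le_mul_of_nonneg_left ht Real.two_pi_pos.le
    calc _ ≤ _ := this
      _ = _ := by ring
  have e4 : 80 * X ≤ Real.pi * (26 * X) := by nlinarith [Real.pi_gt_d2]
  have e5 : 0 ≤ Real.pi * (64 * K * X + 26 * Y) := by positivity
  have e6 := abs_le.mp e1
  have e7 := abs_le.mp e2
  rw [abs_le]
  constructor <;> nlinarith [e6.1, e6.2, e7.1, e7.2]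

/-! ### Best approximation and the upper estimate. -/

theorem bddBelow_lsNorm (m : ℕ) (s : ℝ≥0∞) (φ : ℝ → ℝ) : BddBelow (range
    fun c : (ℕ → ℝ) × (ℕ → ℝ) => lsNorm s (fun x => φ x - trigPoly m c.1 c.2 x)) :=
  ⟨0, by rintro _ ⟨c, rfl⟩; exact ENNReal.toReal_nonneg⟩

theorem bestApprox_nonneg (m : ℕ) (s : ℝ≥0∞) (φ : ℝ → ℝ) : 0 ≤ bestApprox m s φ :=
  Real.iInf_nonneg fun _ => ENNReal.toReal_nonneg

theorem bestApprox_le_lsNorm (m : ℕ) (s : ℝ≥0∞) (φ : ℝ → ℝ) : bestApprox m s φ ≤ lsNorm s φ := by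
  refine (ciInf_le (bddBelow_lsNorm m s φ) (0, 0)).trans (le_of_eq ?_)
  simp [trigPoly]

/-- The affine change acts bijectively on the approximating polynomials, constants being among them
because `m ≥ 1`. -/
theorem bestApprox_mul_sub {m : ℕ} (hm : 1 ≤ m) (s : ℝ≥0∞) (φ : ℝ → ℝ) {c : ℝ} (hc : 0 < c)
    (d : ℝ) : bestApprox m s (fun t => c * (φ t - d)) = c * bestApprox m s φ := by
  rw [bestApprox, bestApprox, Real.mul_iInf_of_nonneg hc.le]
  symm
  refine Function.Surjective.iInf_congr (fun x : (ℕ → ℝ) × (ℕ → ℝ) =>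
    ((fun k => c * x.1 k - if k = 0 then c * d else 0), fun k => c * x.2 k)) ?_ ?_
  · rintro ⟨a, b⟩
    refine ⟨(fun k => (a k + if k = 0 then c * d else 0) / c, fun k => b k / c), ?_⟩
    ext k
    · simp only
      field_simp
      ring
    · simp only
      field_simp
  · rintro ⟨a, b⟩
    rw [← abs_of_pos hc, ← abs_lsNorm_const_mul, abs_of_pos hc]
    congr 1
    funext t
    have : trigPoly m (fun k => c * a k - if k = 0 then c * d else 0) (fun k => c * b k) t =
        c * trigPoly m a b t - c * d := by
      rw [trigPoly, trigPoly, Finset.mul_sum]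
      have h2 : c * d = ∑ k ∈ Finset.range m, if k = 0 then c * d * Real.cos (k * t) else 0 := by
        rw [Finset.sum_ite_eq' (Finset.range m) 0 fun k : ℕ => c * d * Real.cos (k * t),
          if_pos (Finset.mem_range.mpr hm)]
        simp
      conv_rhs => rw [h2]
      rw [← Finset.sum_sub_distrib]
      refine Finset.sum_congr rfl fun k _ => ?_
      split_ifs <;> ring
    rw [this]
    ring

theorem abs_integral_mul_tailKernel_le {m : ℕ} {w : ℕ → ℝ} (hw : Summable fun j => |w j|)
    {s u : ℝ≥0∞} (hs : 1 ≤ s) (hsu : s⁻¹ + u⁻¹ = 1) {φ : ℝ → ℝ} (hφ : MemLp φ s periodMeasure)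
    (γ x : ℝ) : |∫ t, φ t * tailKernel m w γ (x - t) ∂periodMeasure| ≤
      bestApprox m s φ * lsNorm u (tailKernel m w γ) := by
  have hC := tailKernel_memC m hw γ
  rw [bestApprox, Real.iInf_mul_of_nonneg (show 0 ≤ lsNorm u _ from ENNReal.toReal_nonneg)]
  refine le_ciInf fun c => ?_
  have hTc : Continuous (trigPoly m c.1 c.2) := by unfold trigPoly; fun_prop
  have hTp : Function.Periodic (trigPoly m c.1 c.2) (2 * Real.pi) := by
    intro t
    refine Finset.sum_congr rfl fun k _ => ?_
    have h1 := cos_nat_mul_periodic k t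
    have h2 := sin_nat_mul_periodic k t
    simp only at h1 h2
    rw [h1, h2]
  have hkc : Continuous fun t => tailKernel m w γ (x - t) := hC.2.comp (by fun_prop)
  have hkp : Function.Periodic (fun t => tailKernel m w γ (x - t)) (2 * Real.pi) := by
    intro t
    have := hC.1.sub_eq (x - t)
    simp only
    rw [← this]
    ring_nf
  obtain ⟨B, hB⟩ := continuous_bounded_of_periodic hkp hkc
  have hφi : Integrable φ periodMeasure := hφ.integrable hs
  have hTk : Integrable (fun t => trigPoly m c.1 c.2 t * tailKernel m w γ (x - t)) periodMeasure :=
    integrable_periodMeasure (hTc.mul hkc)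
  have hφk : Integrable (fun t => φ t * tailKernel m w γ (x - t)) periodMeasure :=
    hφi.mul_bdd (c := B) hkc.aestronglyMeasurable (Filter.Eventually.of_forall hB)
  have h1 : ∫ t, φ t * tailKernel m w γ (x - t) ∂periodMeasure =
      ∫ t, (φ t - trigPoly m c.1 c.2 t) * tailKernel m w γ (x - t) ∂periodMeasure := by
    simp_rw [sub_mul]
    rw [integral_sub hφk hTk, integral_trigPoly_mul_tailKernel hw, sub_zero]
  rw [h1]
  refine (abs_integral_mul_le_lsNorm hsu (hφ.sub (memLp_of_continuous_periodic hTp hTc s))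
    (memLp_of_continuous_periodic hkp hkc u)).trans (le_of_eq ?_)
  congr 1
  rw [lsNorm, lsNorm, eLpNorm_sub_left hC.1 hC.2]

/-! ### Near-extremal functions for Hölder's inequality. -/

/-- A sign function with values `±1`. -/
noncomputable def signum (x : ℝ) : ℝ := if 0 ≤ x then 1 else -1

theorem abs_signum (x : ℝ) : |signum x| = 1 := by
  unfold signum; split_ifs <;> simp

theorem signum_mul_self (x : ℝ) : signum x * x = |x| := by
  unfold signum
  split_ifs with h
  · rw [abs_of_nonneg h, one_mul]
  · rw [abs_of_neg (not_le.mp h)]; ring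

theorem measurable_signum : Measurable signum :=
  Measurable.ite measurableSet_Ici measurable_const measurable_const

/-- The supremum over the unit ball of `L_1` need not be attained, so the sign of `H` is restricted
to the set where `|H|` is within `ε` of its supremum. This is why `ε` appears throughout. -/
theorem exists_extremal_of_top {H : ℝ → ℝ} (hp : Function.Periodic H (2 * Real.pi))
    (hc : Continuous H) {ε : ℝ} (hε : 0 < ε) (hN : ε < lsNorm ∞ H) :
    ∃ φ : ℝ → ℝ, Function.Periodic φ (2 * Real.pi) ∧ Measurable φ ∧ (∃ B, ∀ t, ‖φ t‖ ≤ B) ∧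
      0 < ∫ t, φ t * H t ∂periodMeasure ∧
      (lsNorm ∞ H - ε) * lsNorm 1 φ ≤ ∫ t, φ t * H t ∂periodMeasure := by
  set N := lsNorm ∞ H with hNd
  set A : Set ℝ := {t | N - ε < |H t|} with hA
  have hAm : MeasurableSet A := (isOpen_lt continuous_const hc.abs).measurableSet
  have hbound : ∀ t, ‖A.indicator (fun t => signum (H t)) t‖ ≤ 1 := by
    intro t
    refine (norm_indicator_le_norm_self _ _).trans (le_of_eq ?_)
    exact abs_signum _
  have hmeas : Measurable (A.indicator fun t => signum (H t)) :=
    (measurable_signum.comp hc.measurable).indicator hAm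
  have hpos : 0 < periodMeasure.real A := by
    rw [Measure.real, ENNReal.toReal_pos_iff]
    refine ⟨?_, measure_lt_top _ _⟩
    rw [pos_iff_ne_zero]
    intro h
    have h2 : ∀ᵐ t ∂periodMeasure, ‖H t‖ ≤ N - ε := by
      have : {t | ¬ ‖H t‖ ≤ N - ε} = A := by ext t; simp [hA]
      rwa [ae_iff, this]
    have h3 : lsNorm ∞ H ≤ N - ε := by
      rw [lsNorm, eLpNorm_exponent_top]
      exact ENNReal.toReal_le_of_le_ofReal (by linarith) (eLpNormEssSup_le_of_ae_bound h2)
    linarith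
  have hint : (N - ε) * periodMeasure.real A ≤
      ∫ t, A.indicator (fun t => signum (H t)) t * H t ∂periodMeasure := by
    have e1 : ∀ t, A.indicator (fun t => signum (H t)) t * H t = A.indicator (fun t => |H t|) t := by
      intro t
      by_cases h : t ∈ A
      · simp [h, signum_mul_self]
      · simp [h]
    simp_rw [e1]
    rw [integral_indicator hAm]
    have e2 := setIntegral_mono_on (μ := periodMeasure) (s := A) (f := fun _ => N - ε)
      (g := fun t => |H t|) (integrable_const _).integrableOn
      (integrable_periodMeasure hc.abs).integrableOn hAm fun t ht => le_of_lt ht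
    rwa [setIntegral_const, smul_eq_mul, mul_comm] at e2
  refine ⟨A.indicator fun t => signum (H t), fun t => ?_, hmeas, ⟨1, hbound⟩, ?_, ?_⟩
  · have : t + 2 * Real.pi ∈ A ↔ t ∈ A := by simp only [hA, mem_ofPred_eq, hp t]
    by_cases h : t ∈ A
    · rw [indicator_of_mem h, indicator_of_mem (this.mpr h), hp t]
    · rw [indicator_of_notMem h, indicator_of_notMem (fun h' => h (this.mp h'))]
  · exact (mul_pos (by linarith) hpos).trans_le hint
  · refine le_trans (mul_le_mul_of_nonneg_left ?_ (by linarith)) hint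
    rw [lsNorm, eLpNorm_one_eq_lintegral_enorm,
      ← integral_norm_eq_lintegral_enorm hmeas.aestronglyMeasurable]
    have e1 : ∀ t, ‖A.indicator (fun t => signum (H t)) t‖ = A.indicator (fun _ => (1 : ℝ)) t := by
      intro t
      by_cases h : t ∈ A
      · simp [h, abs_signum]
      · simp [h]
    simp_rw [e1]
    rw [integral_indicator hAm, setIntegral_const, smul_eq_mul, mul_one]

theorem exists_extremal_of_ne_top {H : ℝ → ℝ} (hp : Function.Periodic H (2 * Real.pi))
    (hc : Continuous H) {s u : ℝ≥0∞} (hs : 1 ≤ s) (hu : 1 ≤ u) (hut : u ≠ ∞) (hsu : s⁻¹ + u⁻¹ = 1)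
    (hN : 0 < lsNorm u H) :
    ∃ φ : ℝ → ℝ, Function.Periodic φ (2 * Real.pi) ∧ Measurable φ ∧ (∃ B, ∀ t, ‖φ t‖ ≤ B) ∧
      0 < ∫ t, φ t * H t ∂periodMeasure ∧
      lsNorm u H * lsNorm s φ ≤ ∫ t, φ t * H t ∂periodMeasure := by
  have hu0 : u ≠ 0 := (zero_lt_one.trans_le hu).ne'
  have hs0 : s ≠ 0 := (zero_lt_one.trans_le hs).ne'
  set r := u.toReal with hr
  have hr1 : 1 ≤ r := by simpa using ENNReal.toReal_mono hut hu
  set φ : ℝ → ℝ := fun t => |H t| ^ (r - 1) * signum (H t) with hφ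
  have hφp : Function.Periodic φ (2 * Real.pi) := fun t => by simp only [hφ, hp t]
  have hpc : Continuous fun t => |H t| ^ (r - 1) :=
    hc.abs.rpow_const fun t => Or.inr (by linarith)
  have hφm : Measurable φ := hpc.measurable.mul (measurable_signum.comp hc.measurable)
  have hφn : ∀ t, ‖φ t‖ = |H t| ^ (r - 1) := fun t => by
    rw [hφ, Real.norm_eq_abs, abs_mul, abs_signum, mul_one, abs_of_nonneg (by positivity)]
  have hφb : ∃ B, ∀ t, ‖φ t‖ ≤ B := by
    obtain ⟨B, hB⟩ := continuous_bounded_of_periodic (h := fun t => |H t| ^ (r - 1))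
      (fun t => by simp only [hp t]) hpc
    exact ⟨B, fun t => by
      rw [hφn]
      exact (le_abs_self _).trans (hB t)⟩
  have hφH : ∀ t, φ t * H t = |H t| ^ r := fun t => by
    rw [hφ, mul_assoc, signum_mul_self]
    rcases eq_or_ne (H t) 0 with h | h
    · rw [h, abs_zero, mul_zero, Real.zero_rpow (by linarith)]
    · rw [← Real.rpow_add_one (abs_ne_zero.mpr h), sub_add_cancel]
  simp_rw [← Real.norm_eq_abs] at hφH
  have hNI : lsNorm u H = (∫ t, ‖H t‖ ^ r ∂periodMeasure) ^ r⁻¹ := by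
    rw [lsNorm, (memLp_of_continuous_periodic hp hc u).eLpNorm_eq_integral_rpow_norm hu0 hut,
      ENNReal.toReal_ofReal (by positivity)]
  set I := ∫ t, ‖H t‖ ^ r ∂periodMeasure with hI
  have hI0 : 0 ≤ I := integral_nonneg fun t => by positivity
  have hIpos : 0 < I := by
    refine lt_of_le_of_ne hI0 fun h => ?_
    rw [hNI, ← h, Real.zero_rpow (inv_ne_zero (by linarith))] at hN
    exact lt_irrefl _ hN
  refine ⟨φ, hφp, hφm, hφb, ?_, ?_⟩
  · simp_rw [hφH]; exact hIpos
  · simp_rw [hφH]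
    rw [← hI, hNI]
    rcases eq_or_ne s ∞ with rfl | hst
    · have hu1 : u = 1 := by
        rw [ENNReal.inv_top, zero_add] at hsu
        simpa using hsu
      have hr1' : r = 1 := by rw [hr, hu1]; simp
      have h1 : lsNorm ∞ φ ≤ 1 := by
        rw [lsNorm, eLpNorm_exponent_top]
        refine ENNReal.toReal_le_of_le_ofReal zero_le_one (eLpNormEssSup_le_of_ae_bound ?_)
        refine Filter.Eventually.of_forall fun t => ?_
        -- For `r = 1` the modulus is `1` everywhere, including the zeros of `H`, by the convention
        -- `0 ^ 0 = 1`.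
        rw [hφn, hr1', sub_self, Real.rpow_zero]
      rw [hr1', inv_one, Real.rpow_one]
      exact mul_le_of_le_one_right hI0 h1
    · have hconj : s.toReal⁻¹ + r⁻¹ = 1 := by
        have := congrArg ENNReal.toReal hsu
        rwa [ENNReal.toReal_add (by simpa using hs0) (by simpa using hu0), ENNReal.toReal_inv,
          ENNReal.toReal_inv, ENNReal.toReal_one] at this
      have hsr : 0 < s.toReal := ENNReal.toReal_pos hs0 hst
      obtain ⟨B, hB⟩ := hφb
      have hφL : MemLp φ s periodMeasure :=
        MemLp.of_bound hφm.aestronglyMeasurable B (Filter.Eventually.of_forall hB)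
      -- Conjugacy of the exponents reads `(r - 1) s = r`, the equality case of Hölder.
      have e : ∀ t, ‖φ t‖ ^ s.toReal = ‖H t‖ ^ r := by
        intro t
        rw [hφn, ← Real.rpow_mul (abs_nonneg _), Real.norm_eq_abs]
        congr 1
        have hr0 : r ≠ 0 := by linarith
        field_simp at hconj
        linarith
      rw [lsNorm, hφL.eLpNorm_eq_integral_rpow_norm hs0 hst, ENNReal.toReal_ofReal (by positivity)]
      simp_rw [e]
      rw [← hI, ← Real.rpow_add hIpos, add_comm, hconj, Real.rpow_one]

theorem exists_extremal {H : ℝ → ℝ} (hp : Function.Periodic H (2 * Real.pi))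
    (hc : Continuous H) {s u : ℝ≥0∞} (hs : 1 ≤ s) (hu : 1 ≤ u) (hsu : s⁻¹ + u⁻¹ = 1)
    {ε : ℝ} (hε : 0 < ε) (hN : ε < lsNorm u H) :
    ∃ φ : ℝ → ℝ, Function.Periodic φ (2 * Real.pi) ∧ Measurable φ ∧ (∃ B, ∀ t, ‖φ t‖ ≤ B) ∧
      0 < ∫ t, φ t * H t ∂periodMeasure ∧
      (lsNorm u H - ε) * lsNorm s φ ≤ ∫ t, φ t * H t ∂periodMeasure := by
  rcases eq_or_ne u ∞ with rfl | hut
  · have hs1 : s = 1 := by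
      rw [ENNReal.inv_top, add_zero] at hsu
      simpa using hsu
    rw [hs1]
    exact exists_extremal_of_top hp hc hε hN
  · obtain ⟨φ, h1, h2, h3, h4, h5⟩ := exists_extremal_of_ne_top hp hc hs hu hut hsu (by linarith)
    refine ⟨φ, h1, h2, h3, h4, le_trans (mul_le_mul_of_nonneg_right ?_ ENNReal.toReal_nonneg) h5⟩
    linarith

/-- Summability of `ψ` makes the integrated series absolutely convergent, so every mean-zero
summable periodic `φ` is the derivative of a continuous function. -/
theorem exists_isPsiBetaDeriv {ψ : ℕ → ℝ} (hψ : ∀ k, 0 < ψ k) (hψs : Summable ψ) (β : ℝ)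
    {φ : ℝ → ℝ} (hφ : MemLs 1 φ) (h0 : cosCoeff φ 0 = 0) :
    ∃ F : ℝ → ℝ, MemC F ∧ IsPsiBetaDeriv ψ β F φ := by
  set D := (1 / Real.pi) * ∫ t, |φ t| ∂periodMeasure
  set a : ℕ → ℝ := fun k => ψ k * (cosCoeff φ k * Real.cos (β * Real.pi / 2) -
    sinCoeff φ k * Real.sin (β * Real.pi / 2)) with ha
  set b : ℕ → ℝ := fun k => ψ k * (cosCoeff φ k * Real.sin (β * Real.pi / 2) +
    sinCoeff φ k * Real.cos (β * Real.pi / 2)) with hb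
  have has : Summable fun k => |a k| :=
    Summable.of_nonneg_of_le (fun _ => abs_nonneg _) (fun k =>
      abs_mul_sub_mul_le (hψ _).le (abs_cosCoeff_le hφ _) (abs_sinCoeff_le hφ _)
        (Real.abs_cos_le_one _) (Real.abs_sin_le_one _)) (hψs.mul_right (2 * D))
  have hbs : Summable fun k => |b k| :=
    Summable.of_nonneg_of_le (fun _ => abs_nonneg _) (fun k =>
      abs_mul_add_mul_le (hψ _).le (abs_cosCoeff_le hφ _) (abs_sinCoeff_le hφ _)
        (Real.abs_sin_le_one _) (Real.abs_cos_le_one _)) (hψs.mul_right (2 * D))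
  have hF := trigSeries_memC has hbs
  refine ⟨trigSeries a b, hF, ⟨hF.1, memLp_of_continuous_periodic hF.1 hF.2 1⟩, hφ, h0,
    fun k hk x => ?_⟩
  rw [cosCoeff_trigSeries has hbs, sinCoeff_trigSeries has hbs, if_neg (by omega),
    if_neg (by omega), add_zero, ha, hb, Real.cos_add, Real.sin_add]
  have := (hψ k).ne'
  field_simp
  linear_combination (-(cosCoeff φ k * Real.cos (k * x)) - sinCoeff φ k * Real.sin (k * x)) *
    Real.sin_sq_add_cos_sq (β * Real.pi / 2)

/-! ### Sharpness and assembly. -/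

/-- An extremal function is centred, so that it can be a derivative, and scaled to the prescribed
best approximation. Centring changes neither the best approximation nor the integral, the kernel
being orthogonal to constants. Since the best approximation is at most the norm, near-extremality
survives replacing the one by the other. -/
theorem exists_bestApprox_eq_and_le_integral {m : ℕ} (hm : 1 ≤ m) {w : ℕ → ℝ}
    (hw : Summable fun j => |w j|) {s u : ℝ≥0∞} (hs : 1 ≤ s) (hu : 1 ≤ u) (hsu : s⁻¹ + u⁻¹ = 1)
    (γ : ℝ) {ε E : ℝ} (hε : 0 < ε) (hN : ε < lsNorm u (tailKernel m w γ)) (hE : 0 < E) :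
    ∃ φ : ℝ → ℝ, MemLs 1 φ ∧ MemLs s φ ∧ cosCoeff φ 0 = 0 ∧ bestApprox m s φ = E ∧
      (lsNorm u (tailKernel m w γ) - ε) * E ≤
        ∫ t, φ t * tailKernel m w γ (0 - t) ∂periodMeasure := by
  have hC := tailKernel_memC m hw γ
  have hkc : Continuous fun t => tailKernel m w γ (0 - t) := hC.2.comp (by fun_prop)
  have hkp : Function.Periodic (fun t => tailKernel m w γ (0 - t)) (2 * Real.pi) := by
    intro t
    have := hC.1.sub_eq (0 - t)
    simp only
    rw [← this]
    ring_nf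
  have hNe : lsNorm u (fun t => tailKernel m w γ (0 - t)) = lsNorm u (tailKernel m w γ) := by
    rw [lsNorm, lsNorm, eLpNorm_sub_left hC.1 hC.2]
  obtain ⟨φ, h1, h2, ⟨B, hB⟩, h3, h4⟩ := exists_extremal hkp hkc hs hu hsu hε (by rwa [hNe])
  rw [hNe] at h4
  set N := lsNorm u (tailKernel m w γ)
  have hL : ∀ v, MemLp φ v periodMeasure := fun v =>
    MemLp.of_bound h2.aestronglyMeasurable B (Filter.Eventually.of_forall hB)
  have hφi : Integrable φ periodMeasure := (hL 1).integrable le_rfl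
  have hb := abs_integral_mul_tailKernel_le (m := m) hw hs hsu (hL s) γ 0
  set J := ∫ t, φ t * tailKernel m w γ (0 - t) ∂periodMeasure
  have hN0 : 0 < N := hε.trans hN
  -- A positive pairing with the kernel is incompatible with zero best approximation, so the
  -- rescaling is legitimate.
  have he : 0 < bestApprox m s φ := by
    rw [abs_of_pos h3] at hb
    exact pos_of_mul_pos_left (h3.trans_le hb) hN0.le
  set e := bestApprox m s φ
  set d := (∫ t, φ t ∂periodMeasure) / (2 * Real.pi) with hd
  set c := E / e with hc
  have hc0 : 0 < c := div_pos hE he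
  have hΦp : Function.Periodic (fun t => c * (φ t - d)) (2 * Real.pi) := fun t => by
    simp only [h1 t]
  have hΦL : ∀ v, MemLp (fun t => c * (φ t - d)) v periodMeasure := fun v =>
    ((hL v).sub (memLp_const d)).const_mul c
  refine ⟨fun t => c * (φ t - d), ⟨hΦp, hΦL 1⟩, ⟨hΦp, hΦL s⟩, ?_, ?_, ?_⟩
  · rw [cosCoeff_eq hΦp]
    simp only [Nat.cast_zero, zero_mul, Real.cos_zero, mul_one]
    rw [integral_const_mul, integral_sub hφi (integrable_const _), integral_const,
      periodMeasure_real_univ, smul_eq_mul, hd, mul_div_cancel₀ _ Real.two_pi_pos.ne', sub_self]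
    simp
  · rw [bestApprox_mul_sub hm s φ hc0, hc, div_mul_cancel₀ _ he.ne']
  · have hT := integral_trigPoly_mul_tailKernel (m := m) hw (fun k => if k = 0 then d else 0) 0 γ 0
    have hT1 : ∀ t, trigPoly m (fun k => if k = 0 then d else 0) 0 t = d := by
      intro t
      rw [trigPoly, Finset.sum_eq_single 0]
      · simp
      · intro k _ hk; simp [hk]
      · intro h; exact absurd (Finset.mem_range.mpr hm) h
    simp_rw [hT1] at hT
    have hφk : Integrable (fun t => φ t * tailKernel m w γ (0 - t)) periodMeasure := by
      obtain ⟨B', hB'⟩ := continuous_bounded_of_periodic hkp hkc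
      exact hφi.mul_bdd (c := B') hkc.aestronglyMeasurable (Filter.Eventually.of_forall hB')
    have e1 : ∀ t, c * (φ t - d) * tailKernel m w γ (0 - t) =
        c * (φ t * tailKernel m w γ (0 - t) - d * tailKernel m w γ (0 - t)) := fun t => by ring
    simp_rw [e1]
    rw [integral_const_mul, integral_sub hφk (integrable_periodMeasure (hkc.const_mul d)), hT,
      sub_zero]
    have e2 : (N - ε) * e ≤ J :=
      (mul_le_mul_of_nonneg_left (bestApprox_le_lsNorm m s φ) (by linarith)).trans h4
    calc (N - ε) * E = c * ((N - ε) * e) := by rw [hc]; field_simp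
      _ ≤ c * J := mul_le_mul_of_nonneg_left e2 hc0.le

theorem exists_abs_le_and_eq {c M R A E X : ℝ} (hc : 0 < c) (hR : 0 < R) (hA : 0 ≤ A) (hE : 0 ≤ E)
    (h1 : c * (M - A * R) * E ≤ X) (h2 : X ≤ c * (M + A * R) * E) :
    ∃ θ, |θ| ≤ A ∧ X = c * (M + θ * R) * E := by
  rcases hE.eq_or_lt with rfl | hE
  · refine ⟨0, by simpa, ?_⟩
    rw [mul_zero] at h1 h2 ⊢
    exact le_antisymm h2 h1
  · refine ⟨(X / (c * E) - M) / R, ?_, ?_⟩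
    · rw [abs_le, le_div_iff₀ hR, div_le_iff₀ hR]
      constructor
      · have : M - A * R ≤ X / (c * E) := by
          rw [le_div_iff₀ (by positivity)]; linarith
        linarith
      · have : X / (c * E) ≤ M + A * R := by
          rw [div_le_iff₀ (by positivity)]; linarith
        linarith
    · field_simp
      ring

theorem one_le_of_inv_add_inv {s u : ℝ≥0∞} (h : s⁻¹ + u⁻¹ = 1) : 1 ≤ u := by
  rw [← ENNReal.inv_le_one, ← h]
  exact le_add_self

section Deviation

variable {q β : ℝ} {l n p : ℕ} {s u : ℝ≥0∞} {f φ : ℝ → ℝ}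

theorem abs_deviation_le (h0 : 0 < q) (h1 : q < 1) (hs : 1 ≤ s) (hsu : s⁻¹ + u⁻¹ = 1) (hp : 1 ≤ p)
    (hpn : p ≤ n) (hf : MemCPsiBeta (polyPsi q l) β s f φ) (x : ℝ) :
    |deviation n p f x| ≤ (1 / Real.pi) * (bestApprox (n - p + 1) s φ *
      lsNorm u (tailKernel (n - p + 1) (kernelWeight q l (n - p + 1) p) (-(β * Real.pi / 2)))) / p := by
  have hp0 : (0 : ℝ) < p := by exact_mod_cast hp
  have h := deviation_eq_integral (polyPsi_pos h0 h1 l) (summable_polyPsi h0 h1 l) hf.1 hf.2.1 hp hpn x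
  have h2 := abs_integral_mul_tailKernel_le (m := n - p + 1) (summable_abs_kernelWeight h0 h1 l (n - p + 1) p) hs hsu
    hf.2.2.2 (-(β * Real.pi / 2)) x
  rw [le_div_iff₀ hp0, mul_comm, ← abs_of_pos hp0, ← abs_mul, h, abs_mul,
    abs_of_pos (by positivity : 0 < 1 / Real.pi)]
  exact mul_le_mul_of_nonneg_left h2 (by positivity)

theorem bddAbove_abs_deviation (h0 : 0 < q) (h1 : q < 1) (hs : 1 ≤ s) (hsu : s⁻¹ + u⁻¹ = 1)
    (hp : 1 ≤ p) (hpn : p ≤ n) (hf : MemCPsiBeta (polyPsi q l) β s f φ) :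
    BddAbove (range fun x => |deviation n p f x|) :=
  ⟨_, by rintro _ ⟨x, rfl⟩; exact abs_deviation_le h0 h1 hs hsu hp hpn hf x⟩

theorem cNorm_deviation_le {A : ℝ} (h0 : 0 < q) (h1 : q < 1) (hs : 1 ≤ s) (hsu : s⁻¹ + u⁻¹ = 1)
    (hp : 1 ≤ p) (hpn : p ≤ n) (hf : MemCPsiBeta (polyPsi q l) β s f φ)
    (hA : lsNorm u (tailKernel (n - p + 1) (kernelWeight q l (n - p + 1) p) (-(β * Real.pi / 2))) ≤
      polyPsi q l (n - p + 1) *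
        (Real.pi * (mainTerm q p u + A * remainder q l (n - p + 1) p s u))) :
    cNorm (deviation n p f) ≤ polyPsi q l (n - p + 1) / p *
      (mainTerm q p u + A * remainder q l (n - p + 1) p s u) * bestApprox (n - p + 1) s φ := by
  refine ciSup_le fun x => (abs_deviation_le h0 h1 hs hsu hp hpn hf x).trans ?_
  have h2 := mul_le_mul_of_nonneg_left hA (bestApprox_nonneg (n - p + 1) s φ)
  have h3 := div_le_div_of_nonneg_right (mul_le_mul_of_nonneg_left h2
    (by positivity : 0 ≤ 1 / Real.pi)) (Nat.cast_nonneg (α := ℝ) p)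
  refine h3.trans (le_of_eq ?_)
  have := Real.pi_ne_zero
  field_simp

/-- The passage from `A - 1` to `A` frees exactly `ε = ψ π R` for the near-extremal function, whose
deviation is evaluated at `0`. -/
theorem exists_le_cNorm_deviation {A : ℝ} (h0 : 0 < q) (h1 : q < 1) (hl : 1 ≤ l) (hs : 1 ≤ s)
    (hsu : s⁻¹ + u⁻¹ = 1) (hp : 1 ≤ p) (hpn : p ≤ n) (hf : MemCPsiBeta (polyPsi q l) β s f φ)
    (hA : polyPsi q l (n - p + 1) *
        (Real.pi * (mainTerm q p u - (A - 1) * remainder q l (n - p + 1) p s u)) ≤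
      lsNorm u (tailKernel (n - p + 1) (kernelWeight q l (n - p + 1) p) (-(β * Real.pi / 2)))) :
    ∃ F Φ : ℝ → ℝ, MemCPsiBeta (polyPsi q l) β s F Φ ∧
      bestApprox (n - p + 1) s Φ = bestApprox (n - p + 1) s φ ∧
      polyPsi q l (n - p + 1) / p * (mainTerm q p u - A * remainder q l (n - p + 1) p s u) *
        bestApprox (n - p + 1) s Φ ≤ cNorm (deviation n p F) := by
  have hp0 : (0 : ℝ) < p := by exact_mod_cast hp
  have hψ := polyPsi_pos h0 h1 l (n - p + 1)
  have hR := remainder_pos h0 h1 hl (by omega : 1 ≤ n - p + 1) hp s u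
  have hw := summable_abs_kernelWeight h0 h1 l (n - p + 1) p
  have hE := bestApprox_nonneg (n - p + 1) s φ
  set ψ := polyPsi q l (n - p + 1)
  set R := remainder q l (n - p + 1) p s u
  set N := lsNorm u (tailKernel (n - p + 1) (kernelWeight q l (n - p + 1) p) (-(β * Real.pi / 2)))
  set M := mainTerm q p u
  have hε : 0 < ψ * (Real.pi * R) := by positivity
  have hA' : ψ * (Real.pi * (M - A * R)) ≤ N - ψ * (Real.pi * R) := by linarith
  -- In these degenerate cases the claimed lower bound is nonpositive, and `f` itself serves.
  by_cases hcase : bestApprox (n - p + 1) s φ = 0 ∨ N ≤ ψ * (Real.pi * R)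
  · refine ⟨f, φ, hf, rfl, ?_⟩
    have hX : 0 ≤ cNorm (deviation n p f) := Real.iSup_nonneg fun _ => abs_nonneg _
    refine le_trans ?_ hX
    rcases hcase with h | h
    · rw [h, mul_zero]
    · have : ψ * (Real.pi * (M - A * R)) ≤ 0 := by linarith
      have h2 : M - A * R ≤ 0 := by
        by_contra hcon
        push Not at hcon
        have : 0 < ψ * (Real.pi * (M - A * R)) := by positivity
        linarith
      exact mul_nonpos_of_nonpos_of_nonneg
        (mul_nonpos_of_nonneg_of_nonpos (by positivity) h2) hE
  · push Not at hcase
    obtain ⟨Φ, hΦ1, hΦs, hΦ0, hΦE, hint⟩ := exists_bestApprox_eq_and_le_integral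
      (by omega : 1 ≤ n - p + 1) hw hs (one_le_of_inv_add_inv hsu) hsu (-(β * Real.pi / 2)) hε hcase.2
      (lt_of_le_of_ne hE hcase.1.symm)
    obtain ⟨F, hFC, hF⟩ := exists_isPsiBetaDeriv (polyPsi_pos h0 h1 l) (summable_polyPsi h0 h1 l) β
      hΦ1 hΦ0
    have hFm : MemCPsiBeta (polyPsi q l) β s F Φ := ⟨hFC, hF, hΦs⟩
    refine ⟨F, Φ, hFm, hΦE, ?_⟩
    refine le_trans ?_ (le_ciSup (bddAbove_abs_deviation h0 h1 hs hsu hp hpn hFm) 0)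
    refine le_trans ?_ (le_abs_self _)
    have hd := deviation_eq_integral (polyPsi_pos h0 h1 l) (summable_polyPsi h0 h1 l) hFC hF hp hpn 0
    have h4 : ψ * (Real.pi * (M - A * R)) * bestApprox (n - p + 1) s Φ ≤
        Real.pi * (p * deviation n p F 0) := by
      rw [hd, ← mul_assoc Real.pi, mul_one_div_cancel Real.pi_ne_zero, one_mul, hΦE]
      exact (mul_le_mul_of_nonneg_right hA' hE).trans hint
    have h5 : Real.pi * (ψ * (M - A * R) * bestApprox (n - p + 1) s Φ) ≤
        Real.pi * (p * deviation n p F 0) := by linarith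
    have h6 := le_of_mul_le_mul_left h5 Real.pi_pos
    rw [div_mul_eq_mul_div, div_mul_eq_mul_div, div_le_iff₀ hp0]
    linarith

end Deviation

end ValleePoussin

theorem mainTheorem5 :
    ∃ (C : ℝ) (C' : ℕ → ℝ) (N : ℕ → ℝ → ℕ),
      ∀ (l : ℕ) (q β : ℝ) (s s' : ENNReal) (n p : ℕ),
        1 ≤ l → 0 < q → q < 1 → 1 ≤ s → s⁻¹ + s'⁻¹ = 1 → 1 ≤ p → p ≤ n →
        ∀ f φ : ℝ → ℝ, ValleePoussin.MemCPsiBeta (ValleePoussin.polyPsi q l) β s f φ →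
          (∃ θ : ℝ, |θ| ≤ C' l ∧ (N l q ≤ n - p → |θ| ≤ C) ∧
            ValleePoussin.cNorm (ValleePoussin.deviation n p f) ≤
              ValleePoussin.polyPsi q l (n - p + 1) / p *
                (ValleePoussin.mainTerm q p s' +
                  θ * ValleePoussin.remainder q l (n - p + 1) p s s') *
                ValleePoussin.bestApprox (n - p + 1) s φ) ∧
          ∃ F Φ : ℝ → ℝ, ValleePoussin.MemCPsiBeta (ValleePoussin.polyPsi q l) β s F Φ ∧
            ValleePoussin.bestApprox (n - p + 1) s Φ =
              ValleePoussin.bestApprox (n - p + 1) s φ ∧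
            ∃ θ : ℝ, |θ| ≤ C' l ∧ (N l q ≤ n - p → |θ| ≤ C) ∧
              ValleePoussin.cNorm (ValleePoussin.deviation n p F) =
                ValleePoussin.polyPsi q l (n - p + 1) / p *
                  (ValleePoussin.mainTerm q p s' +
                    θ * ValleePoussin.remainder q l (n - p + 1) p s s') *
                  ValleePoussin.bestApprox (n - p + 1) s Φ := by
  open ValleePoussin in
  -- `91 = 26 + 64 + 1`: the kernel estimate with `K = 1` plus one unit for near-extremality. The
  -- threshold guarantees `2l / (1 - q) ≤ m`, where `K = 1` is allowed; otherwise `K = polyConst l`.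
  refine ⟨91, fun l => 91 + 64 * polyConst l, fun l q => ⌈2 * (l : ℝ) / (1 - q)⌉₊, ?_⟩
  intro l q β s u n p hl h0 h1 hs hsu hp hpn f φ hf
  have hPC : 0 ≤ polyConst l := by unfold polyConst; positivity
  have hm : 1 ≤ n - p + 1 := by omega
  have hψ := polyPsi_pos h0 h1 l (n - p + 1)
  have hR := remainder_pos h0 h1 hl hm hp s u
  have hp0 : (0 : ℝ) < p := by exact_mod_cast hp
  have hu := one_le_of_inv_add_inv hsu
  obtain ⟨A, hA0, hAC', hAC, hA⟩ : ∃ A : ℝ, 0 ≤ A ∧ A ≤ 91 + 64 * polyConst l ∧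
      (⌈2 * (l : ℝ) / (1 - q)⌉₊ ≤ n - p → A ≤ 91) ∧
      |lsNorm u (tailKernel (n - p + 1) (kernelWeight q l (n - p + 1) p) (-(β * Real.pi / 2))) -
          polyPsi q l (n - p + 1) * (Real.pi * mainTerm q p u)| ≤
        polyPsi q l (n - p + 1) * (Real.pi * ((A - 1) * remainder q l (n - p + 1) p s u)) := by
    by_cases hN : ⌈2 * (l : ℝ) / (1 - q)⌉₊ ≤ n - p
    · refine ⟨91, by norm_num, by linarith, fun _ => le_rfl, ?_⟩
      have hN' : 2 * (l : ℝ) / (1 - q) ≤ (n - p + 1 : ℕ) :=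
        (Nat.ceil_le.mp hN).trans (by exact_mod_cast Nat.le_succ _)
      refine (abs_lsNorm_kernel_sub_le h0 h1 hp hm hu hsu (-(β * Real.pi / 2)) zero_le_one fun j =>
        sum_polyTerm_mul_le_of_large h0 h1 hm hN').trans (le_of_eq ?_)
      norm_num
    · refine ⟨27 + 64 * polyConst l, by positivity, by linarith, fun h => absurd h hN, ?_⟩
      refine (abs_lsNorm_kernel_sub_le h0 h1 hp hm hu hsu (-(β * Real.pi / 2)) hPC fun j =>
        sum_polyTerm_mul_le h0 h1 hm).trans (le_of_eq ?_)
      ring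
  have hAl := abs_le.mp hA
  have hψR : 0 ≤ polyPsi q l (n - p + 1) * (Real.pi * remainder q l (n - p + 1) p s u) :=
    (mul_pos hψ (mul_pos Real.pi_pos hR)).le
  refine ⟨⟨A, ?_, fun h => ?_, ?_⟩, ?_⟩
  · rwa [abs_of_nonneg hA0]
  · rw [abs_of_nonneg hA0]; exact hAC h
  · exact cNorm_deviation_le h0 h1 hs hsu hp hpn hf (by linarith [hAl.2])
  · obtain ⟨F, Φ, hF, hE, hle⟩ := exists_le_cNorm_deviation (A := A) h0 h1 hl hs hsu hp hpn hf
      (by linarith [hAl.1])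
    have hge := cNorm_deviation_le (A := A) h0 h1 hs hsu hp hpn hF (by linarith [hAl.2])
    obtain ⟨θ, hθ, hθe⟩ := exists_abs_le_and_eq (div_pos hψ hp0) hR hA0
      (bestApprox_nonneg (n - p + 1) s Φ) hle hge
    exact ⟨F, Φ, hF, hE, θ, hθ.trans hAC', fun h => hθ.trans (hAC h), hθe⟩
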